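/- **Hardy placement under a real-axis spectral hypothesis.** Let $\mathbb H_+=\{z\in\mathbb C:\operatorname{Im}z>0\}$. For a complex Banach space $E$ and $0<p\le\infty$, $H^p(E)$ is the set of analytic $F:\mathbb H_+\to E$ with $\sup_{y>0}\|F(\cdot+iy)\|_{L^p(\mathbb R;E)}<\infty$. For $w:\mathbb R\to E$, say that $F$ is the Cauchy transform of $w$ if $F(z)=\int_{\mathbb R}\frac{w(\lambda)}{z-\lambda}\,d\lambda$ for all $z\in\mathbb H_+$. Consider a $d$-level system coupled to a bath with arbitrary Hilbert space $\mathcal H_b$, a (possibly unbounded) self-adjoint Hamiltonian $H$ on $\mathbb C^d\otimes\mathcal H_b$, and a density operator $\rho_b$ on $\mathcal H_b$. On trace-class operators put $\mathcal L=[H,\cdot\,]$, $P\rho=\operatorname{Tr}_b[\rho]\otimes\rho_b$, $Q=1-P$. Suppose that (the closure of) $iQ\mathcal LQ$ generates a strongly continuous semigroup $e^{iQ\mathcal LQt}$, $t\ge0$, and that the Nakajima–Zwanzig memory kernel $\mathcal K(t)=P\mathcal LQ\,e^{iQ\mathcal LQt}\,Q\mathcal LP$ is defined on the range of $P$; by $\sigma\mapsto\sigma\otimes\rho_b$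 it is read as an operator on the system Liouville space of $d\times d$ matrices with the Hilbert–Schmidt norm. Let $\mathcal B$ be the space of operators on this Liouville space with the operator norm, and let $\tilde{\mathcal K}(z)=\int_0^\infty e^{izt}\mathcal K(t)\,dt$, assumed absolutely convergent for $z\in\mathbb H_+$. 1. If $\tilde{\mathcal K}$ is the Cauchy transform of some $w\in L^1(\mathbb R;\mathcal B)\cap L^{p_0}(\mathbb R;\mathcal B)$ with $1<p_0\le\infty$, then $\tilde{\mathcal K}\in H^p(\mathcal B)$ for every finite $p$ with $1<p\le p_0$. More generally (for any other choice of projection and inner product), the same holds when $\mathcal B$ is the space of operators on any finite-dimensional complex inner product space and $\tilde{\mathcal K}:\mathbb H_+\to\mathcal B$ is any function that is the Cauchy transform of such a $w$. For the rest let $\mathcal B$ be as in the general form of 1. For a bath spectral density $J$ on $(0,\infty)$ and $\beta>0$ let $S_{J}(\lambda)=J(\lambda)/(1-e^{-\beta\lambda})$, with $J$ extended to an odd function on $\mathbb R$ (the thermal power spectrum of the bath correlation function, up to a constant), and consider densities $w=S_J\cdot A$ with a fixed $A\in\mathcal B$ (the density at lowest, Born, order in the coupling). 2. For an Ohmic bath,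 $J(\omega)=\eta\,\omega e^{-\omega/\omega_c}$ with $\eta,\omega_c>0$, and for a Lorentzian one, $w(\lambda)=\frac{\gamma}{(\lambda-\omega_0)^2+\gamma^2}A$ with $\gamma>0$, $\omega_0\in\mathbb R$: $w\in L^1$, and for every finite $p>1$ one has $w\in L^p$ and the Cauchy transform of $w$ is in $H^p(\mathcal B)$. For a Drude–Lorentz bath, $J(\omega)=2\Lambda\gamma\omega/(\omega^2+\gamma^2)$ with $\Lambda,\gamma>0$: for every finite $p>1$, $w\in L^p$ and the Cauchy transform of $w$ is in $H^p(\mathcal B)$. 3. Let $0<s<1$. If $\|w(\lambda)\|$ is of exact order $|\lambda|^{s-1}$ as $\lambda\to0$ and $w\in L^{p_0}(\mathbb R;\mathcal B)$, then $p_0<1/(1-s)$. If, in addition, $w\in L^1$ and $w\in L^q(\{|\lambda|\ge\delta\})$ for all $\delta>0$ and all finite $q\ge1$, then the admissible range is exactly $(1,1/(1-s))$: for $p>1$, $w\in L^p$ if and only if $p<1/(1-s)$, and for these $p$ the Cauchy transform of $w$ is in $H^p(\mathcal B)$. All these assumptions on $w$ hold for sub-Ohmic baths, that is, for $w=S_J\cdot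 A$ with $A\ne0$ and $J(\omega)=\eta\,\omega_c^{1-s}\omega^se^{-\omega/\omega_c}$, $\eta,\omega_c>0$; here $S_J(\lambda)/|\lambda|^{s-1}\to\eta\,\omega_c^{1-s}/\beta$ as $\lambda\to0$. The range shrinks to the empty set as $s\to0$: $1/(1-s)\to1$ as $s\to0^+$. -/

import Mathlib

open MeasureTheory Filter Topology Asymptotics Set
open scoped ENNReal NNReal

noncomputable section

/-! ### Vector-valued Hardy spaces and Cauchy transforms -/

/-- The open upper half-plane, as a subset of `ℂ`. -/
def upperHalf : Set ℂ := {z : ℂ | 0 < z.im}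

/-- The Hardy norm on the upper half-plane,
`sup_{y > 0} (∫ ‖F (x + i y)‖ ^ p dx) ^ (1 / p)` (essential supremum for `p = ∞`). -/
def hardyNorm {E : Type*} [NormedAddCommGroup E] (p : ℝ≥0∞) (F : ℂ → E) : ℝ≥0∞ :=
  ⨆ (y : ℝ) (_ : 0 < y), eLpNorm (fun x : ℝ => F ((x : ℂ) + (y : ℂ) * Complex.I)) p volume

/-- `F` (restricted to the upper half-plane) belongs to the Hardy space `H^p` with values
in `E`: it is analytic in the upper half-plane and its Hardy norm is finite. -/
structure MemHardy {E : Type*} [NormedAddCommGroup E] [NormedSpace ℂ E]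
    (p : ℝ≥0∞) (F : ℂ → E) : Prop where
  analytic : DifferentiableOn ℂ F upperHalf
  bounded : hardyNorm p F < ⊤

/-- `F z = ∫ w(l) / (z - l) dl` at every point of the upper half-plane. -/
def IsCauchyTransform {E : Type*} [NormedAddCommGroup E] [NormedSpace ℂ E]
    (w : ℝ → E) (F : ℂ → E) : Prop :=
  ∀ z ∈ upperHalf, F z = ∫ l : ℝ, (1 / (z - (l : ℂ))) • w l

/-- `F` is the Laplace transform `F z = ∫_0^∞ e^{i z t} K(t) dt` of `K`, which is required to
converge absolutely at every point of the upper half-plane. -/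
def IsLaplaceTransform {E : Type*} [NormedAddCommGroup E] [NormedSpace ℂ E]
    (K : ℝ → E) (F : ℂ → E) : Prop :=
  ∀ z ∈ upperHalf,
    IntegrableOn (fun t : ℝ => Complex.exp (Complex.I * z * (t : ℂ)) • K t) (Ioi 0) ∧
      F z = ∫ t in Ioi (0 : ℝ), Complex.exp (Complex.I * z * (t : ℂ)) • K t

/-! ### Trace-class operators -/

/-- The trace norm of a bounded operator on a Hilbert space: the supremum of
`∑ |⟨e_i, T f_i⟩|` over all finite orthonormal families `e`, `f` of equal length. -/
def traceNorm {E : Type*} [NormedAddCommGroup E] [InnerProductSpace ℂ E]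
    (T : E →L[ℂ] E) : ℝ≥0∞ :=
  ⨆ (n : ℕ) (e : Fin n → E) (f : Fin n → E) (_ : Orthonormal ℂ e) (_ : Orthonormal ℂ f),
    ∑ i, ENNReal.ofReal ‖inner ℂ (e i) (T (f i))‖

/-- Trace-class operators. -/
def IsTraceClass {E : Type*} [NormedAddCommGroup E] [InnerProductSpace ℂ E]
    (T : E →L[ℂ] E) : Prop :=
  traceNorm T < ⊤

/-- The trace of a (trace-class) operator, `∑ ⟨x, T x⟩` over a Hilbert basis. -/
def opTrace {E : Type*} [NormedAddCommGroup E] [InnerProductSpace ℂ E] [CompleteSpace E]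
    (T : E →L[ℂ] E) : ℂ :=
  ∑' x : (exists_hilbertBasis ℂ E).choose, inner ℂ (x : E) (T (x : E))

/-! ### The Nakajima-Zwanzig memory kernel -/

/-- The Liouville space of a `d`-level system: `d × d` matrices `σ` with the Hilbert-Schmidt
inner product `Tr(A† B) = ∑ conj(A i j) B i j`. -/
abbrev SysLiouville (d : ℕ) : Type := EuclideanSpace ℂ (Fin d × Fin d)

/-- The composite Hilbert space `ℂ^d ⊗ H_b`, realised as the Hilbert sum of `d` copies of
`H_b`. -/
abbrev Composite (d : ℕ) (Hb : Type*) [NormedAddCommGroup Hb] [InnerProductSpace ℂ Hb] : Type _ :=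
  PiLp 2 (fun _ : Fin d => Hb)

/-- The embedding `v ↦ e_i ⊗ v` of the bath space into the composite space. -/
def embedAt {d : ℕ} {Hb : Type*} [NormedAddCommGroup Hb] [InnerProductSpace ℂ Hb] (i : Fin d) :
    Hb →L[ℂ] Composite d Hb :=
  (PiLp.continuousLinearEquiv 2 ℂ (fun _ : Fin d => Hb)).symm.toContinuousLinearMap ∘L
    ContinuousLinearMap.single ℂ (fun _ : Fin d => Hb) i

/-- The `(i, j)` block of an operator on the composite space, an operator on the bath. -/
def block {d : ℕ} {Hb : Type*} [NormedAddCommGroup Hb] [InnerProductSpace ℂ Hb]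
    (T : Composite d Hb →L[ℂ] Composite d Hb) (i j : Fin d) : Hb →L[ℂ] Hb :=
  PiLp.proj 2 (fun _ : Fin d => Hb) i ∘L T ∘L embedAt j

/-- The partial trace over the bath. -/
def partialTrace {d : ℕ} {Hb : Type*} [NormedAddCommGroup Hb] [InnerProductSpace ℂ Hb]
    [CompleteSpace Hb] (T : Composite d Hb →L[ℂ] Composite d Hb) : SysLiouville d :=
  WithLp.toLp 2 (fun ij : Fin d × Fin d => opTrace (block T ij.1 ij.2))

/-- The operator `σ ⊗ ρ` on the composite space. -/
def tensorOp {d : ℕ} {Hb : Type*} [NormedAddCommGroup Hb] [InnerProductSpace ℂ Hb]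
    (σ : SysLiouville d) (ρ : Hb →L[ℂ] Hb) : Composite d Hb →L[ℂ] Composite d Hb :=
  ∑ i : Fin d, ∑ j : Fin d, σ (i, j) • (embedAt i ∘L ρ ∘L PiLp.proj 2 (fun _ : Fin d => Hb) j)

/-- A `d`-level system coupled to a bath with Hilbert space `Hb`: a (possibly unbounded)
self-adjoint total Hamiltonian on `ℂ^d ⊗ H_b` and a reference state of the bath. -/
structure OpenSystem (d : ℕ) (Hb : Type*) [NormedAddCommGroup Hb] [InnerProductSpace ℂ Hb]
    [CompleteSpace Hb] where
  /-- the total Hamiltonian -/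
  H : Composite d Hb →ₗ.[ℂ] Composite d Hb
  selfAdjoint_H : IsSelfAdjoint H
  /-- the reference density operator of the bath -/
  ρref : Hb →L[ℂ] Hb
  pos_ρref : ρref.IsPositive
  traceClass_ρref : IsTraceClass ρref
  trace_ρref : opTrace ρref = 1

namespace OpenSystem

variable {d : ℕ} {Hb : Type*} [NormedAddCommGroup Hb] [InnerProductSpace ℂ Hb] [CompleteSpace Hb]

/-- The projection `P T = Tr_b[T] ⊗ ρref`. -/
def P (S : OpenSystem d Hb) (T : Composite d Hb →L[ℂ] Composite d Hb) :
    Composite d Hb →L[ℂ] Composite d Hb :=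
  tensorOp (partialTrace T) S.ρref

/-- The complementary projection `Q = 1 - P`. -/
def Q (S : OpenSystem d Hb) (T : Composite d Hb →L[ℂ] Composite d Hb) :
    Composite d Hb →L[ℂ] Composite d Hb :=
  T - S.P T

/-- The graph of the Liouvillian `L T = [H, T]` on trace-class operators: `T` is in the domain
and `L T = X` when `T` preserves the domain of `H` and the commutator `H T - T H`, defined on
the domain of `H`, is the restriction of the trace-class operator `X`. -/
def IsLiouvillian (S : OpenSystem d Hb) (T X : Composite d Hb →L[ℂ] Composite d Hb) : Prop :=
  IsTraceClass T ∧ IsTraceClass X ∧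
    ∀ ψ : S.H.domain, ∃ h : T (ψ : Composite d Hb) ∈ S.H.domain,
      X (ψ : Composite d Hb) = S.H ⟨T (ψ : Composite d Hb), h⟩ - T (S.H ψ)

/-- The graph of the projected Liouvillian `Q L Q`, on its natural domain. -/
def IsProjLiouvillian (S : OpenSystem d Hb) (T Y : Composite d Hb →L[ℂ] Composite d Hb) : Prop :=
  IsTraceClass T ∧ ∃ X, S.IsLiouvillian (S.Q T) X ∧ Y = S.Q X

/-- `U t = exp(i Q L Q t)`, `t ≥ 0`: the strongly continuous semigroup on the Banach space of
trace-class operators whose infinitesimal generator is the closure of `i Q L Q`. The values of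
`U` on other operators and at negative times are irrelevant. -/
structure IsProjectedPropagator (S : OpenSystem d Hb)
    (U : ℝ → (Composite d Hb →L[ℂ] Composite d Hb) → (Composite d Hb →L[ℂ] Composite d Hb)) :
    Prop where
  traceClass : ∀ t, 0 ≤ t → ∀ T, IsTraceClass T → IsTraceClass (U t T)
  map_add : ∀ t, 0 ≤ t → ∀ T T', IsTraceClass T → IsTraceClass T' →
    U t (T + T') = U t T + U t T'
  map_smul : ∀ t, 0 ≤ t → ∀ (c : ℂ) (T), IsTraceClass T → U t (c • T) = c • U t T
  bounded : ∀ t, 0 ≤ t → ∃ C : ℝ≥0, ∀ T, IsTraceClass T → traceNorm (U t T) ≤ C * traceNorm T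
  zero : ∀ T, IsTraceClass T → U 0 T = T
  semigroup : ∀ s t, 0 ≤ s → 0 ≤ t → ∀ T, IsTraceClass T → U (s + t) T = U s (U t T)
  continuous : ∀ T, IsTraceClass T →
    Tendsto (fun t : ℝ => traceNorm (U t T - T)) (𝓝[>] 0) (𝓝 0)
  generator : ∀ T Y, IsTraceClass T → IsTraceClass Y →
    (Tendsto (fun t : ℝ => traceNorm (((t : ℂ)⁻¹) • (U t T - T) - Y)) (𝓝[>] 0) (𝓝 0) ↔
      ∀ ε : ℝ≥0∞, 0 < ε → ∃ T' Y', S.IsProjLiouvillian T' Y' ∧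
        traceNorm (T - T') < ε ∧ traceNorm (Y - Complex.I • Y') < ε)

/-- `K` is the Nakajima-Zwanzig memory kernel `K(t) = P L Q exp(i Q L Q t) Q L P`, `t ≥ 0`, read
as a superoperator of the system through `σ ↦ σ ⊗ ρref` and the partial trace; all operator
products are evaluated on their natural domains. -/
def IsMemoryKernel (S : OpenSystem d Hb) (K : ℝ → SysLiouville d →L[ℂ] SysLiouville d) : Prop :=
  ∃ U, S.IsProjectedPropagator U ∧
    ∀ t, 0 ≤ t → ∀ σ : SysLiouville d, ∃ X Y,
      S.IsLiouvillian (tensorOp σ S.ρref) X ∧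
      S.IsLiouvillian (S.Q (U t (S.Q X))) Y ∧
      K t σ = partialTrace Y

end OpenSystem

/-! ### Baths -/

/-- The power spectrum of the equilibrium correlation function of a bosonic bath with spectral
density `J` (given for positive frequencies) at inverse temperature `β`, up to a constant factor:
`J(l) / (1 - exp(-β l))` with `J` extended to an odd function. -/
def thermalSpectrum (β : ℝ) (J : ℝ → ℝ) (l : ℝ) : ℝ :=
  SignType.sign l * J |l| / (1 - Real.exp (-β * l))

/-- The spectral density `η ω^s e^{-ω/ωc} / ωc^{s-1}`: Ohmic for `s = 1`, sub-Ohmic for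
`0 < s < 1`. -/
def powerLawJ (η ωc s ω : ℝ) : ℝ := η * ω ^ s * Real.exp (-ω / ωc) / ωc ^ (s - 1)

/-- The Drude-Lorentz spectral density `2 Λ γ ω / (ω² + γ²)`. -/
def drudeLorentzJ (Λ γ ω : ℝ) : ℝ := 2 * Λ * γ * ω / (ω ^ 2 + γ ^ 2)

/-- The Lorentzian line with centre `ω₀` and half-width `γ`. -/
def lorentzian (ω₀ γ l : ℝ) : ℝ := γ / ((l - ω₀) ^ 2 + γ ^ 2)

/-- An operator-valued density with the sub-Ohmic behaviour of exponent `s`: it is integrable,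
its norm is of exact order `|l|^(s-1)` at `0`, and away from `0` it is in all `L^q`, `q`
finite. -/
structure IsSubOhmicDensity {E : Type*} [NormedAddCommGroup E] (s : ℝ) (w : ℝ → E) : Prop where
  integrable : Integrable w
  near_zero : (fun l : ℝ => ‖w l‖) =Θ[𝓝[≠] 0] (fun l : ℝ => |l| ^ (s - 1))
  away : ∀ δ : ℝ, 0 < δ → ∀ q : ℝ≥0∞, 1 ≤ q → q ≠ ⊤ →
    MemLp w q (volume.restrict {l : ℝ | δ ≤ |l|})

end

/-! ### The Cauchy kernel -/

section CauchyKernel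

/-! Everything rests on the M. Riesz inequality `exists_eLpNorm_cauchyLine_le`: for `1 < p < ∞`, the
map taking `w` to its Cauchy integral on the line `Im z = y` is bounded on `L^p(ℝ)`, with a constant
that does not depend on `y`. Uniformity in `y` is exactly finiteness of the Hardy norm. Analyticity
comes from differentiating under the integral sign. An operator-valued density on a
finite-dimensional space is treated coordinate by coordinate, and `L^1 ∩ L^{p₀}` densities reach the
intermediate exponents by interpolation.

The inequality is proved by Calderón's method. For `w ≥ 0` and `F` its Cauchy integral, `i F` has
positive real part, namely the Poisson integral of `w`. Hence `(i F)^p` is analytic, and if `w` has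
bounded support it decays like `|z|^{-p}`, so its integral over a horizontal line vanishes. For `1 <
p ≤ 2` there is a pointwise inequality `|ζ|^p ≤ A (Re ζ)^p - B Re ζ^p` on the right half-plane.
Integrated at `ζ = i F` it bounds the `L^p` norm of `F` by that of a Poisson integral, which Young's
inequality controls. Splitting `w` into four nonnegative parts removes the sign condition, Fatou's
lemma removes the support condition, and duality gives `p > 2`, since the transpose of the Cauchy
integral is the same operator up to sign and conjugation.

For the baths, only the size of the densities matters. The factor `l / (1 - e^{-βl})` is at most
`1/β + |l|` in absolute value and tends to `1/β` at `0`, so integrability is read off from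
`J(|l|)/|l|`. In the sub-Ohmic case the threshold `1/(1-s)` is where `|l|^{(s-1)p}` becomes
`|l|^{-1}`. -/

theorem im_le_norm_sub_ofReal (z : ℂ) (l : ℝ) : z.im ≤ ‖z - l‖ := by
  simpa using (le_abs_self _).trans (Complex.abs_im_le_norm (z - l))

theorem sub_ofReal_ne_zero {z : ℂ} (hz : 0 < z.im) (l : ℝ) : z - l ≠ 0 := by
  rw [← norm_pos_iff]
  exact hz.trans_le (im_le_norm_sub_ofReal z l)

/-- For fixed `z` the kernel is comparable with `(1 + |l|)⁻¹`, hence lies in every `L^p` with `p >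
1` but not in `L^1`. -/
theorem one_add_abs_le_mul_norm_sub {z : ℂ} (hz : 0 < z.im) (l : ℝ) :
    1 + |l| ≤ ((1 + ‖z‖) / z.im + 1) * ‖z - l‖ := by
  have h1 := im_le_norm_sub_ofReal z l
  have h2 : |l| ≤ ‖z‖ + ‖z - l‖ := by
    have := norm_sub_norm_le (l : ℂ) z
    rw [norm_sub_rev, Complex.norm_real, Real.norm_eq_abs] at this
    linarith
  have h3 : 1 + ‖z‖ ≤ (1 + ‖z‖) / z.im * ‖z - l‖ := by
    rw [div_mul_eq_mul_div, le_div_iff₀ hz]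
    gcongr
  linarith

/-- The same comparison with the roles exchanged: `l` stays bounded and the constant is uniform over
the half-plane `Im z ≥ y`. -/
theorem one_add_norm_le_mul_norm_sub {z : ℂ} {y R l : ℝ} (hy : 0 < y) (hz : y ≤ z.im)
    (hl : |l| ≤ R) : 1 + ‖z‖ ≤ ((1 + R) / y + 1) * ‖z - l‖ := by
  have h1 := hz.trans (im_le_norm_sub_ofReal z l)
  have h2 : ‖z‖ ≤ R + ‖z - l‖ := by
    have := norm_sub_norm_le z (l : ℂ)
    rw [Complex.norm_real, Real.norm_eq_abs] at this
    linarith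
  have hR : 0 ≤ R := (abs_nonneg l).trans hl
  have h3 : 1 + R ≤ (1 + R) / y * ‖z - l‖ := by
    rw [div_mul_eq_mul_div, le_div_iff₀ hy]
    gcongr
  linarith

theorem continuous_cauchyKernel {z : ℂ} (hz : 0 < z.im) :
    Continuous fun l : ℝ => 1 / (z - (l : ℂ)) :=
  continuous_const.div (by fun_prop) (sub_ofReal_ne_zero hz)

theorem norm_cauchyKernel_le {z : ℂ} (hz : 0 < z.im) (l : ℝ) :
    ‖1 / (z - (l : ℂ))‖ ≤ ((1 + ‖z‖) / z.im + 1) * (1 + |l|)⁻¹ := by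
  have h0 : 0 < ‖z - l‖ := norm_pos_iff.2 (sub_ofReal_ne_zero hz l)
  rw [norm_div, norm_one, div_le_iff₀ h0, mul_right_comm, ← div_eq_mul_inv,
    one_le_div (by positivity)]
  exact one_add_abs_le_mul_norm_sub hz l

theorem memLp_inv_one_add_abs {p : ℝ≥0∞} (hp : 1 < p) :
    MemLp (fun x : ℝ => (1 + |x|)⁻¹) p := by
  have hc : Continuous fun x : ℝ => (1 + |x|)⁻¹ :=
    Continuous.inv₀ (by fun_prop) fun x => by positivity
  rcases eq_or_ne p ⊤ with rfl | hpt
  · refine memLp_top_of_bound hc.aestronglyMeasurable 1 (ae_of_all _ fun x => ?_)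
    rw [Real.norm_of_nonneg (by positivity)]
    exact inv_le_one_of_one_le₀ (by linarith [abs_nonneg x])
  · have h0 : p ≠ 0 := (zero_lt_one.trans hp).ne'
    rw [← integrable_norm_rpow_iff hc.aestronglyMeasurable h0 hpt]
    have h1 : (Module.finrank ℝ ℝ : ℝ) < p.toReal := by
      simpa using (ENNReal.toReal_lt_toReal ENNReal.one_ne_top hpt).2 hp
    refine (integrable_one_add_norm h1).congr (ae_of_all _ fun x => ?_)
    have : 0 ≤ 1 + |x| := by positivity
    simp only [Real.norm_eq_abs, abs_inv, abs_of_nonneg this, Real.inv_rpow this,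
      Real.rpow_neg this]

theorem memLp_cauchyKernel {z : ℂ} (hz : 0 < z.im) {p : ℝ≥0∞} (hp : 1 < p) :
    MemLp (fun l : ℝ => 1 / (z - (l : ℂ))) p := by
  refine (memLp_inv_one_add_abs hp).of_le_mul (c := (1 + ‖z‖) / z.im + 1)
    (continuous_cauchyKernel hz).aestronglyMeasurable (ae_of_all _ fun l => ?_)
  have : 0 ≤ (1 + |l|)⁻¹ := by positivity
  rw [Real.norm_of_nonneg this]
  exact norm_cauchyKernel_le hz l

variable {E : Type*} [NormedAddCommGroup E] [NormedSpace ℂ E]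

/-- Hölder's inequality. Finiteness of `p` makes the conjugate exponent exceed `1`, as the kernel
requires. The density need not be integrable, which matters for Drude-Lorentz baths. -/
theorem integrable_cauchyKernel_smul {w : ℝ → E} {p : ℝ≥0∞} (hp : 1 < p) (hpt : p ≠ ⊤)
    (hw : MemLp w p) {z : ℂ} (hz : 0 < z.im) :
    Integrable fun l : ℝ => (1 / (z - (l : ℂ))) • w l := by
  rw [← memLp_one_iff_integrable]
  have hq : 1 < p.conjExponent := by
    rw [ENNReal.conjExponent]
    exact ENNReal.lt_add_right ENNReal.one_ne_top (by simpa using hpt)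
  have : p.HolderConjugate p.conjExponent := ENNReal.HolderConjugate.conjExponent hp.le
  have : p.conjExponent.HolderTriple p 1 := ENNReal.HolderConjugate.symm
  exact hw.smul (memLp_cauchyKernel hz hq)

theorem integrable_cauchyKernel_smul_of_integrable {w : ℝ → E} (hw : Integrable w) {z : ℂ}
    (hz : 0 < z.im) : Integrable fun l : ℝ => (1 / (z - (l : ℂ))) • w l := by
  refine hw.bdd_smul (1 / z.im) (continuous_cauchyKernel hz).aestronglyMeasurable
    (ae_of_all _ fun l => ?_)
  rw [norm_div, norm_one]
  exact one_div_le_one_div_of_le hz (im_le_norm_sub_ofReal z l)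

/-- A Cauchy integral that converges absolutely is analytic in the upper half-plane. -/
theorem differentiableOn_cauchyIntegral {w : ℝ → E} (hm : AEStronglyMeasurable w)
    (hw : ∀ z : ℂ, 0 < z.im → Integrable fun l : ℝ => (1 / (z - (l : ℂ))) • w l) :
    DifferentiableOn ℂ (fun z : ℂ => ∫ l : ℝ, (1 / (z - (l : ℂ))) • w l) upperHalf := by
  intro z hz
  have hz : 0 < z.im := hz
  -- On the ball of radius `Im z / 2`, both `Im z / 2` and `‖z - l‖ / 2` bound `‖x - l‖` from below.
  -- Using one for each factor of `(x - l)²` dominates the derivative by `4 / Im z` times the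
  -- integrand at `z`.
  have key : ∀ l : ℝ, ∀ x ∈ Metric.ball z (z.im / 2), 0 < x.im ∧ z.im / 2 ≤ ‖x - l‖ ∧
      ‖z - l‖ / 2 ≤ ‖x - l‖ := by
    intro l x hx
    rw [mem_ball_iff_norm] at hx
    have h1 := im_le_norm_sub_ofReal z l
    have h2 : ‖z - l‖ ≤ ‖x - l‖ + ‖x - z‖ := by
      have := norm_sub_le (x - l) (x - z)
      simpa using this
    have h3 := (neg_abs_le _).trans' (neg_le_neg (Complex.abs_im_le_norm (x - z)))
    rw [Complex.sub_im] at h3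
    exact ⟨by linarith, by linarith, by linarith⟩
  refine (hasDerivAt_integral_of_dominated_loc_of_deriv_le
    (F := fun (x : ℂ) (l : ℝ) => (1 / (x - (l : ℂ))) • w l)
    (F' := fun (x : ℂ) (l : ℝ) => ((-1 : ℂ) / (x - (l : ℂ)) ^ 2) • w l)
    (bound := fun l : ℝ => 4 / z.im * ‖(1 / (z - (l : ℂ))) • w l‖)
    (Metric.ball_mem_nhds z (half_pos hz)) ?_ (hw z hz) ?_ ?_ ((hw z hz).norm.const_mul _)
    ?_).2.differentiableAt.differentiableWithinAt
  · filter_upwards [Metric.ball_mem_nhds z (half_pos hz)] with x hx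
    exact (continuous_cauchyKernel (key 0 x hx).1).aestronglyMeasurable.smul hm
  · refine AEStronglyMeasurable.smul (Continuous.aestronglyMeasurable ?_) hm
    exact continuous_const.div (by fun_prop) fun l => pow_ne_zero 2 (sub_ofReal_ne_zero hz l)
  · refine ae_of_all _ fun l x hx => ?_
    obtain ⟨-, h1, h2⟩ := key l x hx
    have h0 : 0 < ‖z - l‖ := norm_pos_iff.2 (sub_ofReal_ne_zero hz l)
    rw [norm_smul, norm_smul, ← mul_assoc]
    gcongr
    rw [norm_div, norm_neg, norm_one, norm_pow, norm_div, norm_one, div_mul_div_comm, mul_one,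
      div_le_div_iff₀ (by nlinarith) (by positivity)]
    nlinarith
  · refine ae_of_all _ fun l x hx => HasDerivAt.smul_const ?_ _
    have h0 := sub_ofReal_ne_zero (key l x hx).1 l
    have := ((hasDerivAt_id x).sub_const (l : ℂ)).inv h0
    simp only [one_div]
    exact this

/-- Bounded support gives decay of order `1/‖z‖`, uniform on `Im z ≥ y`. This is what makes the
Cauchy integral `L^p` on lines and lets the contour be closed at infinity. -/
theorem norm_cauchyIntegral_le {w : ℝ → E} {R y : ℝ} (hw : Integrable w)
    (hsupp : ∀ l, R < |l| → w l = 0) (hy : 0 < y) {z : ℂ} (hz : y ≤ z.im) :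
    ‖∫ l : ℝ, (1 / (z - (l : ℂ))) • w l‖ ≤ ((1 + R) / y + 1) * (∫ l, ‖w l‖) / (1 + ‖z‖) := by
  have hz0 := hy.trans_le hz
  rw [mul_div_right_comm, ← integral_const_mul]
  refine norm_integral_le_of_norm_le (hw.norm.const_mul _) (ae_of_all _ fun l => ?_)
  rcases le_or_gt |l| R with hl | hl
  · rw [norm_smul]
    gcongr
    rw [norm_div, norm_one, div_le_div_iff₀ (norm_pos_iff.2 (sub_ofReal_ne_zero hz0 l))
      (by positivity), one_mul]
    exact one_add_norm_le_mul_norm_sub hy hz hl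
  · simp [hsupp l hl]

end CauchyKernel

/-! ### Young's inequality and the Poisson kernel -/

section Poisson

/-- Young's inequality for an `L^1` kernel: Hölder applied to `k W = k^{1/q} · (k^{1/p} W)` bounds
the inner integral pointwise, and Tonelli with translation invariance does the rest. -/
theorem lintegral_convolution_rpow_le {k W : ℝ → ℝ≥0∞} (hk : Measurable k) (hW : AEMeasurable W)
    {p : ℝ} (hp : 1 < p) :
    ∫⁻ x, (∫⁻ l, k (x - l) * W l) ^ p ≤ (∫⁻ x, k x) ^ p * ∫⁻ l, W l ^ p := by
  have hp0 : 0 < p := by linarith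
  have hpq := Real.HolderConjugate.conjExponent hp
  set q := p.conjExponent
  have hq0 : 0 < q := hpq.symm.pos
  have hone : 1 / q + 1 / p = 1 := by
    have := hpq.inv_add_inv_eq_one
    rw [one_div, one_div, add_comm, this]
  have hkx : ∀ x, Measurable fun l => k (x - l) := fun x =>
    hk.comp (measurable_const.sub measurable_id)
  have hpoint : ∀ x, (∫⁻ l, k (x - l) * W l) ^ p ≤
      (∫⁻ x, k x) ^ (p - 1) * ∫⁻ l, k (x - l) * W l ^ p := by
    intro x
    have h1 := ENNReal.lintegral_mul_le_Lp_mul_Lq volume hpq.symm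
      (f := fun l => k (x - l) ^ (1 / q)) (g := fun l => k (x - l) ^ (1 / p) * W l)
      ((hkx x).pow_const _).aemeasurable (((hkx x).pow_const _).aemeasurable.mul hW)
    have h2 : ∀ l, ((fun l => k (x - l) ^ (1 / q)) * fun l => k (x - l) ^ (1 / p) * W l) l =
        k (x - l) * W l := by
      intro l
      simp only [Pi.mul_apply]
      rw [← mul_assoc, ← ENNReal.rpow_add_of_nonneg _ _ (by positivity) (by positivity), hone,
        ENNReal.rpow_one]
    simp only [h2, ENNReal.mul_rpow_of_nonneg _ _ hp0.le, ← ENNReal.rpow_mul,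
      one_div_mul_cancel hp0.ne', one_div_mul_cancel hq0.ne', ENNReal.rpow_one] at h1
    rw [lintegral_sub_left_eq_self k x] at h1
    calc (∫⁻ l, k (x - l) * W l) ^ p
        ≤ ((∫⁻ x, k x) ^ (1 / q) * (∫⁻ l, k (x - l) * W l ^ p) ^ (1 / p)) ^ p := by gcongr
      _ = _ := by
        rw [ENNReal.mul_rpow_of_nonneg _ _ hp0.le, ← ENNReal.rpow_mul, ← ENNReal.rpow_mul,
          one_div_mul_cancel hp0.ne', ENNReal.rpow_one]
        congr 2
        rw [eq_sub_of_add_eq hone, sub_mul, one_mul, one_div_mul_cancel hp0.ne']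
  calc ∫⁻ x, (∫⁻ l, k (x - l) * W l) ^ p
      ≤ ∫⁻ x, (∫⁻ x, k x) ^ (p - 1) * ∫⁻ l, k (x - l) * W l ^ p := lintegral_mono hpoint
    _ ≤ (∫⁻ x, k x) ^ (p - 1) * ∫⁻ x, ∫⁻ l, k (x - l) * W l ^ p := by
        rw [lintegral_const_mul'']
        exact AEMeasurable.lintegral_prod_right' (f := fun z : ℝ × ℝ => k (z.1 - z.2) * W z.2 ^ p)
          ((hk.comp (measurable_fst.sub measurable_snd)).aemeasurable.mul
            (hW.comp_snd.pow_const _))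
    _ = (∫⁻ x, k x) ^ (p - 1) * ∫⁻ l, (∫⁻ x, k x) * W l ^ p := by
        rw [lintegral_lintegral_swap]
        · congr 1
          refine lintegral_congr fun l => ?_
          rw [lintegral_mul_const (f := fun x => k (x - l)) _ (hk.comp (measurable_id.sub_const l)),
            lintegral_sub_right_eq_self k l]
        · exact (hk.comp (measurable_fst.sub measurable_snd)).aemeasurable.mul
            (hW.comp_snd.pow_const _)
    _ = (∫⁻ x, k x) ^ p * ∫⁻ l, W l ^ p := by
        rw [lintegral_const_mul'' _ (hW.pow_const _), ← mul_assoc]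
        congr 1
        nth_rewrite 2 [← ENNReal.rpow_one (∫⁻ x, k x)]
        rw [← ENNReal.rpow_add_of_nonneg _ _ (by linarith) zero_le_one, sub_add_cancel]

theorem lintegral_poissonKernel {y : ℝ} (hy : 0 < y) :
    ∫⁻ x : ℝ, ENNReal.ofReal (y / (x ^ 2 + y ^ 2)) = ENNReal.ofReal Real.pi := by
  have heq : ∀ x : ℝ, y / (x ^ 2 + y ^ 2) = y⁻¹ * (1 + (x / y) ^ 2)⁻¹ := fun x => by
    field_simp
    ring
  have hint : Integrable fun x : ℝ => y / (x ^ 2 + y ^ 2) := by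
    simp only [heq]
    exact (integrable_inv_one_add_sq.comp_div hy.ne').const_mul _
  rw [← ofReal_integral_eq_lintegral_ofReal hint (ae_of_all _ fun x => by positivity)]
  simp only [heq]
  rw [integral_const_mul, Measure.integral_comp_div (fun x => (1 + x ^ 2)⁻¹),
    integral_univ_inv_one_add_sq, abs_of_pos hy, smul_eq_mul, inv_mul_cancel_left₀ hy.ne']

end Poisson

/-! ### Calderón's inequality and a contour integral -/

section Calderon

/-- Calderón's inequality on the right half-plane. -/
theorem exists_norm_rpow_le_re_rpow_sub {p : ℝ} (hp : 1 < p) (hp2 : p ≤ 2) :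
    ∃ A B : ℝ, 0 ≤ A ∧ 0 ≤ B ∧ ∀ ζ : ℂ, 0 < ζ.re →
      ‖ζ‖ ^ p ≤ A * ζ.re ^ p - B * (ζ ^ (p : ℂ)).re := by
  have hpi := Real.pi_pos
  have hp0 : 0 < p := by linarith
  -- The midpoint of `π/(2p)` and `π/2`: at this angle `cos t > 0` while `cos (p t) < 0`.
  set t := Real.pi / 4 * (1 + 1 / p) with ht
  have hpt : p * t = Real.pi / 4 * (p + 1) := by
    rw [ht]; field_simp
  have ht2 : t < Real.pi / 2 := by
    have : 1 / p < 1 := by rw [div_lt_one hp0]; exact hp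
    rw [ht]; nlinarith
  have ht0 : 0 < t := by positivity
  have hct : 0 < Real.cos t := Real.cos_pos_of_mem_Ioo ⟨by linarith, ht2⟩
  have hcpt : Real.cos (p * t) < 0 := by
    rw [hpt]
    exact Real.cos_neg_of_pi_div_two_lt_of_lt (by nlinarith) (by nlinarith)
  set B := 1 / -Real.cos (p * t) with hB
  have hB0 : 0 ≤ B := one_div_nonneg.2 (by linarith)
  -- Near the imaginary axis (`|arg ζ| ≥ t`) the term with `B` alone contributes at least `1`; here
  -- `p ≤ 2` keeps `p |arg ζ|` within `[0, π]`, where cosine decreases. In the sector `|arg ζ| ≤ t`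
  -- the first term is at least `1 + B`, which absorbs `B cos (p |arg ζ|) ≤ B`.
  refine ⟨(1 + B) / Real.cos t ^ p, B, by positivity, hB0, fun ζ hζ => ?_⟩
  have hre : ζ.re = ‖ζ‖ * Real.cos |ζ.arg| := by rw [Real.cos_abs, Complex.norm_mul_cos_arg]
  have hcpow : (ζ ^ (p : ℂ)).re = ‖ζ‖ ^ p * Real.cos (p * |ζ.arg|) := by
    rw [Complex.cpow_ofReal_re, ← Real.cos_abs (ζ.arg * p), abs_mul, abs_of_pos hp0, mul_comm p]
  have harg : |ζ.arg| < Real.pi / 2 := Complex.abs_arg_lt_pi_div_two_iff.2 (Or.inl hζ)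
  have hcos : 0 < Real.cos |ζ.arg| :=
    Real.cos_pos_of_mem_Ioo ⟨by linarith [abs_nonneg ζ.arg], harg⟩
  rw [hcpow, hre, Real.mul_rpow (norm_nonneg _) hcos.le]
  suffices h : 1 ≤ (1 + B) / Real.cos t ^ p * Real.cos |ζ.arg| ^ p -
      B * Real.cos (p * |ζ.arg|) by
    have := mul_le_mul_of_nonneg_left h (Real.rpow_nonneg (norm_nonneg ζ) p)
    linarith
  rcases le_total t |ζ.arg| with h | h
  · have h1 : Real.cos (p * |ζ.arg|) ≤ Real.cos (p * t) :=
      Real.cos_le_cos_of_nonneg_of_le_pi (by positivity) (by nlinarith) (by gcongr)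
    have h2 : B * -Real.cos (p * t) = 1 := one_div_mul_cancel (by linarith)
    have h3 : 0 ≤ (1 + B) / Real.cos t ^ p * Real.cos |ζ.arg| ^ p := by positivity
    nlinarith
  · have h1 : Real.cos t ≤ Real.cos |ζ.arg| :=
      Real.cos_le_cos_of_nonneg_of_le_pi (abs_nonneg _) (by linarith) h
    have h2 : Real.cos t ^ p ≤ Real.cos |ζ.arg| ^ p := by gcongr
    have h3 : 1 + B ≤ (1 + B) / Real.cos t ^ p * Real.cos |ζ.arg| ^ p := by
      rw [div_mul_eq_mul_div, le_div_iff₀ (by positivity)]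
      gcongr
    nlinarith [Real.cos_le_one (p * |ζ.arg|)]

/-- Cauchy's theorem on the rectangle with base `[-T, T] + iy` and height `T`. The other three sides
have total length `4T` and `f` is at most `C T^{-p}` there, so they contribute at most `4 C
T^{1-p}`, which tends to `0`. -/
theorem integral_horizontal_line_eq_zero {f : ℂ → ℂ} {p y C : ℝ} (hp : 1 < p) (hy : 0 < y)
    (hf : DifferentiableOn ℂ f upperHalf)
    (hbound : ∀ z : ℂ, y ≤ z.im → ‖f z‖ ≤ C * (1 + ‖z‖) ^ (-p))
    (hint : Integrable fun x : ℝ => f (x + y * Complex.I)) :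
    ∫ x : ℝ, f (x + y * Complex.I) = 0 := by
  have hC : 0 ≤ C := by
    have h1 := (norm_nonneg _).trans (hbound (y * Complex.I) (by simp))
    exact nonneg_of_mul_nonneg_left h1 (by positivity)
  have hlim : Tendsto (fun T : ℝ => ∫ x in (-T)..T, f (x + y * Complex.I)) atTop
      (𝓝 (∫ x : ℝ, f (x + y * Complex.I))) :=
    intervalIntegral_tendsto_integral hint tendsto_neg_atTop_atBot tendsto_id
  refine tendsto_nhds_unique hlim (squeeze_zero_norm' (a := fun T : ℝ => 4 * C * T ^ (-(p - 1)))
    ?_ ?_)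
  · filter_upwards [eventually_gt_atTop 0] with T hT
    have hb : ∀ z : ℂ, y ≤ z.im → T ≤ ‖z‖ → ‖f z‖ ≤ C * T ^ (-p) := fun z hz hTz => by
      refine (hbound z hz).trans ?_
      gcongr ?_ * ?_
      exact Real.rpow_le_rpow_of_nonpos hT (by linarith) (by linarith)
    have hrect := Complex.integral_boundary_rect_eq_zero_of_differentiableOn f
      (⟨-T, y⟩ : ℂ) (⟨T, y + T⟩ : ℂ) (hf.mono ?_)
    · simp only at hrect
      have htop : ‖∫ x in (-T)..T, f (x + ((y + T : ℝ) : ℂ) * Complex.I)‖ ≤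
          C * T ^ (-p) * |T - -T| :=
        intervalIntegral.norm_integral_le_of_norm_le_const fun x _ => hb _ (by simp [hT.le])
          ((Complex.abs_im_le_norm _).trans' (by simp [abs_of_pos (by linarith : 0 < y + T), hy.le]))
      have hside : ∀ s : ℝ, |s| = T → ‖∫ x in y..(y + T), f (s + x * Complex.I)‖ ≤
          C * T ^ (-p) * |y + T - y| := fun s hs =>
        intervalIntegral.norm_integral_le_of_norm_le_const fun x hx => by
          rw [uIoc_of_le (by linarith)] at hx
          exact hb _ (by simpa using hx.1.le)
            ((Complex.abs_re_le_norm _).trans' (by simp [hs]))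
      have h1 := hside T (abs_of_pos hT)
      have h2 := hside (-T) (by rw [abs_neg, abs_of_pos hT])
      rw [sub_neg_eq_add, abs_of_pos (by linarith)] at htop
      rw [add_sub_cancel_left, abs_of_pos hT] at h1 h2
      have heq : (∫ x in (-T)..T, f (x + y * Complex.I)) =
          (∫ x in (-T)..T, f (x + ((y + T : ℝ) : ℂ) * Complex.I)) -
          Complex.I • (∫ x in y..(y + T), f ((T : ℝ) + x * Complex.I)) +
          Complex.I • ∫ x in y..(y + T), f (((-T : ℝ) : ℂ) + x * Complex.I) := by
        linear_combination hrect
      have hpow : T ^ (-(p - 1)) = T ^ (-p) * T := by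
        rw [neg_sub, sub_eq_neg_add, Real.rpow_add_one hT.ne']
      rw [heq, hpow]
      refine (norm_add_le _ _).trans ((add_le_add_left (norm_sub_le _ _) _).trans ?_)
      rw [norm_smul, norm_smul, Complex.norm_I, one_mul, one_mul]
      linarith
    · intro z hz
      rw [Complex.mem_reProdIm, uIcc_of_le (a := (⟨-T, y⟩ : ℂ).im) (by simp [hT.le])] at hz
      exact hy.trans_le hz.2.1
  · have := (tendsto_rpow_neg_atTop (by linarith : 0 < p - 1)).const_mul (4 * C)
    simpa using this

end Calderon

/-! ### The M. Riesz inequality -/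

section RieszInequality

/-- Multiplying by `i` rotates the lower half-plane, where `1/(z - l)` lives, onto the right
half-plane; the real part becomes the Poisson kernel (without the factor `1/π`). -/
theorem re_I_mul_cauchyKernel_mul {z : ℂ} (hz : 0 < z.im) (l r : ℝ) :
    (Complex.I * ((1 / (z - (l : ℂ))) • (r : ℂ))).re =
      z.im / ((z.re - l) ^ 2 + z.im ^ 2) * r := by
  have h : (z.re - l) ^ 2 + z.im ^ 2 ≠ 0 := by positivity
  simp [Complex.inv_re, Complex.inv_im, Complex.normSq_apply]
  field_simp

theorem re_I_mul_cauchyIntegral {w : ℝ → ℝ} (hw : Integrable w) {z : ℂ} (hz : 0 < z.im) :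
    Integrable (fun l : ℝ => z.im / ((z.re - l) ^ 2 + z.im ^ 2) * w l) ∧
    (Complex.I * ∫ l : ℝ, (1 / (z - (l : ℂ))) • (w l : ℂ)).re =
      ∫ l : ℝ, z.im / ((z.re - l) ^ 2 + z.im ^ 2) * w l := by
  have hint : Integrable fun l : ℝ => Complex.I * ((1 / (z - (l : ℂ))) • (w l : ℂ)) := by
    exact (integrable_cauchyKernel_smul_of_integrable hw.ofReal hz).const_mul _
  have h1 := hint.re
  have h2 := Complex.reCLM.integral_comp_comm hint
  rw [integral_const_mul] at h2
  simp only [RCLike.re_eq_complex_re, re_I_mul_cauchyKernel_mul hz] at h1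
  simp only [Complex.reCLM_apply, re_I_mul_cauchyKernel_mul hz] at h2
  exact ⟨h1, h2.symm⟩

theorem memLp_cauchyIntegral_of_support {w : ℝ → ℂ} {R y : ℝ} (hw : Integrable w)
    (hsupp : ∀ l, R < |l| → w l = 0) (hy : 0 < y) {p : ℝ≥0∞} (hp : 1 < p) :
    MemLp (fun x : ℝ => ∫ l : ℝ, (1 / ((x + y * Complex.I : ℂ) - (l : ℂ))) • w l) p := by
  have him : ∀ x : ℝ, (x + y * Complex.I : ℂ).im = y := fun x => by simp
  have hd := differentiableOn_cauchyIntegral hw.aestronglyMeasurable fun z hz =>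
    integrable_cauchyKernel_smul_of_integrable hw hz
  have hcont : Continuous fun x : ℝ =>
      ∫ l : ℝ, (1 / ((x + y * Complex.I : ℂ) - (l : ℂ))) • w l :=
    hd.continuousOn.comp_continuous (f := fun x : ℝ => (x + y * Complex.I : ℂ)) (by fun_prop)
      fun x => by simpa [upperHalf] using hy
  refine (memLp_inv_one_add_abs hp).of_le_mul (c := |((1 + R) / y + 1) * (∫ l, ‖w l‖)|)
    hcont.aestronglyMeasurable (ae_of_all _ fun x => ?_)
  have hpos : 0 ≤ (1 + |x|)⁻¹ := by positivity
  rw [Real.norm_of_nonneg hpos, ← div_eq_mul_inv]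
  refine (norm_cauchyIntegral_le hw hsupp hy (him x).ge).trans ?_
  refine div_le_div₀ (abs_nonneg _) (le_abs_self _) (by positivity) ?_
  gcongr
  simpa using Complex.abs_re_le_norm (x + y * Complex.I : ℂ)

/-- The M. Riesz inequality for nonnegative functions and exponents at most two, by Calderón's
argument. -/
theorem exists_eLpNorm_cauchyIntegral_le_of_nonneg {p : ℝ≥0∞} (hp : 1 < p) (hp2 : p ≤ 2) :
    ∃ C : ℝ≥0, ∀ (w : ℝ → ℝ) (R : ℝ), (∀ l, 0 ≤ w l) → Integrable w →
      (∀ l, R < |l| → w l = 0) → ∀ y : ℝ, 0 < y →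
      eLpNorm (fun x : ℝ => ∫ l : ℝ, (1 / ((x + y * Complex.I : ℂ) - (l : ℂ))) • (w l : ℂ)) p ≤
        C * eLpNorm w p := by
  have hpt : p ≠ ⊤ := (hp2.trans_lt (by simp)).ne
  have hp0 : p ≠ 0 := (zero_lt_one.trans hp).ne'
  set r := p.toReal with hr
  have hr1 : 1 < r := by simpa using (ENNReal.toReal_lt_toReal ENNReal.one_ne_top hpt).2 hp
  have hr2 : r ≤ 2 := by simpa using (ENNReal.toReal_le_toReal hpt (by simp)).2 hp2
  have hr0 : 0 < r := by linarith
  obtain ⟨A, B, hA, -, hAB⟩ := exists_norm_rpow_le_re_rpow_sub hr1 hr2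
  -- `A` is Calderón's constant and `π` the total mass of the unnormalised Poisson kernel.
  refine ⟨(A.toNNReal * (Real.pi.toNNReal) ^ r) ^ (1 / r), fun w R hw0 hw hsupp y hy => ?_⟩
  set F : ℂ → ℂ := fun z => ∫ l : ℝ, (1 / (z - (l : ℂ))) • (w l : ℂ) with hF
  have him : ∀ x : ℝ, (x + y * Complex.I : ℂ).im = y := fun x => by simp
  have hre : ∀ x : ℝ, (x + y * Complex.I : ℂ).re = x := fun x => by simp
  -- The null case is separate because the power below needs `Re (i F) > 0` strictly, to stay off
  -- the branch cut.
  rcases eq_or_ne (eLpNorm w p) 0 with h0 | h0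
  · have hw00 := (eLpNorm_eq_zero_iff hw.aestronglyMeasurable hp0).1 h0
    have : ∀ z, F z = 0 := fun z => integral_eq_zero_of_ae <| by
      filter_upwards [hw00] with l hl
      simp [hl]
    change eLpNorm (fun x : ℝ => F (x + y * Complex.I)) p volume ≤ _
    simp [this]
  have hwC : Integrable fun l => (w l : ℂ) := hw.ofReal
  have hsuppC : ∀ l, R < |l| → (w l : ℂ) = 0 := fun l hl => by simp [hsupp l hl]
  have hFd : DifferentiableOn ℂ F upperHalf :=
    differentiableOn_cauchyIntegral hwC.aestronglyMeasurable fun z hz =>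
      integrable_cauchyKernel_smul_of_integrable hwC hz
  have hpos : ∀ z : ℂ, 0 < z.im → 0 < (Complex.I * F z).re := by
    intro z hz
    obtain ⟨h1, h2⟩ := re_I_mul_cauchyIntegral hw hz
    rw [h2]
    have hk : ∀ l, 0 < z.im / ((z.re - l) ^ 2 + z.im ^ 2) := fun l => by positivity
    refine lt_of_le_of_ne (integral_nonneg fun l => mul_nonneg (hk l).le (hw0 l)) fun h => ?_
    rw [eq_comm, integral_eq_zero_iff_of_nonneg (fun l => mul_nonneg (hk l).le (hw0 l)) h1] at h
    refine h0 ((eLpNorm_eq_zero_iff hw.aestronglyMeasurable hp0).2 ?_)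
    filter_upwards [h] with l hl
    exact (mul_eq_zero.1 hl).resolve_left (hk l).ne'
  set f : ℝ → ℂ := fun x => F (x + y * Complex.I) with hf
  have hfL : MemLp f p := memLp_cauchyIntegral_of_support hwC hsuppC hy hp
  have hfint : Integrable fun x => ‖f x‖ ^ r := hfL.integrable_norm_rpow hp0 hpt
  set G : ℂ → ℂ := fun z => (Complex.I * F z) ^ (r : ℂ) with hG
  have hGn : ∀ z, ‖G z‖ = ‖F z‖ ^ r := fun z => by
    simp only [hG]
    rw [Complex.norm_cpow_real, norm_mul, Complex.norm_I, one_mul]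
  have hGd : DifferentiableOn ℂ G upperHalf := (hFd.const_mul Complex.I).cpow_const fun z hz =>
    Or.inl (hpos z hz)
  have hGcont : Continuous fun x : ℝ => G (x + y * Complex.I) :=
    hGd.continuousOn.comp_continuous (f := fun x : ℝ => (x + y * Complex.I : ℂ)) (by fun_prop)
      fun x => by simpa [upperHalf] using hy
  have hGint : Integrable fun x : ℝ => G (x + y * Complex.I) :=
    hfint.mono' hGcont.aestronglyMeasurable (ae_of_all _ fun x => (hGn _).le)
  have hGzero : ∫ x : ℝ, G (x + y * Complex.I) = 0 := by
    refine integral_horizontal_line_eq_zero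
      (C := |((1 + R) / y + 1) * (∫ l, ‖(w l : ℂ)‖)| ^ r) hr1 hy hGd (fun z hz => ?_) hGint
    rw [hGn z, Real.rpow_neg (by positivity), ← div_eq_mul_inv,
      ← Real.div_rpow (abs_nonneg _) (by positivity)]
    gcongr
    refine (norm_cauchyIntegral_le hwC hsuppC hy hz).trans ?_
    gcongr
    exact le_abs_self _
  set u : ℝ → ℝ := fun x => (Complex.I * f x).re with hu
  have hu0 : ∀ x, 0 < u x := fun x => hpos _ (by simpa using hy)
  have hum : AEStronglyMeasurable u := (hfL.1.const_mul Complex.I).re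
  have huint : Integrable fun x => u x ^ r := by
    refine hfint.mono' (hum.aemeasurable.pow_const r).aestronglyMeasurable
      (ae_of_all _ fun x => ?_)
    rw [Real.norm_of_nonneg (Real.rpow_nonneg (hu0 x).le r)]
    refine Real.rpow_le_rpow (hu0 x).le ?_ hr0.le
    refine (Complex.re_le_norm (Complex.I * f x)).trans_eq ?_
    rw [norm_mul, Complex.norm_I, one_mul]
  -- The `B` term integrates to the real part of a vanishing line integral, so only the Poisson
  -- integral `u` survives.
  have hmain : ∫ x, ‖f x‖ ^ r ≤ A * ∫ x, u x ^ r := by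
    have hGre : ∫ x : ℝ, (G (x + y * Complex.I)).re = 0 := by
      have := Complex.reCLM.integral_comp_comm hGint
      rw [hGzero] at this
      simpa using this
    have hGreint : Integrable fun x : ℝ => (G (x + y * Complex.I)).re := hGint.re
    calc ∫ x, ‖f x‖ ^ r ≤ ∫ x : ℝ, (A * u x ^ r - B * (G (x + y * Complex.I)).re) := by
          refine integral_mono hfint ((huint.const_mul A).sub (hGint.re.const_mul B)) fun x => ?_
          have := hAB (Complex.I * f x) (hu0 x)
          rwa [norm_mul, Complex.norm_I, one_mul] at this
      _ = A * ∫ x, u x ^ r := by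
          rw [integral_sub (huint.const_mul A)
            (hGreint.const_mul B), integral_const_mul,
            integral_const_mul, hGre, mul_zero, sub_zero]
  have hul : ∀ x, ENNReal.ofReal (u x) =
      ∫⁻ l, ENNReal.ofReal (y / ((x - l) ^ 2 + y ^ 2)) * ‖w l‖ₑ := by
    intro x
    obtain ⟨h1, h2⟩ := re_I_mul_cauchyIntegral hw (z := x + y * Complex.I) (by simpa using hy)
    have h3 : u x = _ := h2
    rw [him, hre] at h1 h3
    rw [h3, ofReal_integral_eq_lintegral_ofReal h1
      (ae_of_all _ fun l => mul_nonneg (by positivity) (hw0 l))]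
    refine lintegral_congr fun l => ?_
    rw [ENNReal.ofReal_mul (by positivity), Real.enorm_of_nonneg (hw0 l)]
  have hlint : ∫⁻ x, ‖f x‖ₑ ^ r ≤ ENNReal.ofReal A * (ENNReal.ofReal Real.pi ^ r *
      ∫⁻ l, ‖w l‖ₑ ^ r) := by
    calc ∫⁻ x, ‖f x‖ₑ ^ r = ENNReal.ofReal (∫ x, ‖f x‖ ^ r) := by
          rw [ofReal_integral_eq_lintegral_ofReal hfint (ae_of_all _ fun x => by positivity)]
          refine lintegral_congr fun x => ?_
          rw [← ENNReal.ofReal_rpow_of_nonneg (norm_nonneg _) hr0.le, ofReal_norm]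
      _ ≤ ENNReal.ofReal (A * ∫ x, u x ^ r) := ENNReal.ofReal_le_ofReal hmain
      _ = ENNReal.ofReal A * ∫⁻ x, ENNReal.ofReal (u x) ^ r := by
          rw [ENNReal.ofReal_mul hA, ofReal_integral_eq_lintegral_ofReal huint
            (ae_of_all _ fun x => Real.rpow_nonneg (hu0 x).le r)]
          congr 1
          refine lintegral_congr fun x => ?_
          rw [ENNReal.ofReal_rpow_of_nonneg (hu0 x).le hr0.le]
      _ ≤ _ := by
          gcongr
          simp only [hul]
          rw [← lintegral_poissonKernel hy]
          exact lintegral_convolution_rpow_le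
            (k := fun x => ENNReal.ofReal (y / (x ^ 2 + y ^ 2))) (by fun_prop)
            hw.aestronglyMeasurable.enorm hr1
  rw [eLpNorm_eq_lintegral_rpow_enorm_toReal hp0 hpt, eLpNorm_eq_lintegral_rpow_enorm_toReal hp0 hpt,
    ← hr]
  calc (∫⁻ x, ‖f x‖ₑ ^ r) ^ (1 / r) ≤ (ENNReal.ofReal A * (ENNReal.ofReal Real.pi ^ r *
      ∫⁻ l, ‖w l‖ₑ ^ r)) ^ (1 / r) := by gcongr
    _ = _ := by
      rw [← mul_assoc, ENNReal.mul_rpow_of_nonneg _ _ (by positivity)]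
      congr 1
      rw [ENNReal.coe_rpow_of_nonneg _ (by positivity), ENNReal.coe_mul,
        ENNReal.coe_rpow_of_nonneg _ hr0.le]
      rfl

/-- The Cauchy integral of `w` on the horizontal line `Im z = y`. -/
noncomputable def cauchyLine (y : ℝ) (w : ℝ → ℂ) (x : ℝ) : ℂ :=
  ∫ l : ℝ, (1 / ((x + y * Complex.I : ℂ) - (l : ℂ))) • w l

theorem memLp_cauchyLine_of_support {w : ℝ → ℂ} {R y : ℝ} (hw : Integrable w)
    (hsupp : ∀ l, R < |l| → w l = 0) (hy : 0 < y) {p : ℝ≥0∞} (hp : 1 < p) :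
    MemLp (cauchyLine y w) p :=
  memLp_cauchyIntegral_of_support hw hsupp hy hp

theorem integrable_cauchyLine {w : ℝ → ℂ} (hw : Integrable w) {y : ℝ} (hy : 0 < y) (x : ℝ) :
    Integrable fun l : ℝ => (1 / ((x + y * Complex.I : ℂ) - (l : ℂ))) • w l :=
  integrable_cauchyKernel_smul_of_integrable hw (by simpa using hy)

theorem cauchyLine_add {v w : ℝ → ℂ} (hv : Integrable v) (hw : Integrable w) {y : ℝ}
    (hy : 0 < y) : cauchyLine y (v + w) = cauchyLine y v + cauchyLine y w := by
  funext x
  simp only [cauchyLine, Pi.add_apply, smul_add]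
  exact integral_add (integrable_cauchyLine hv hy x) (integrable_cauchyLine hw hy x)

theorem cauchyLine_const_smul (c : ℂ) (w : ℝ → ℂ) (y : ℝ) :
    cauchyLine y (c • w) = c • cauchyLine y w := by
  funext x
  simp only [cauchyLine, Pi.smul_apply, smul_comm _ c]
  exact integral_smul c _

/-- The factor `4` counts the positive and negative parts of the real and imaginary parts, each
dominated pointwise by `‖w‖`. -/
theorem exists_eLpNorm_cauchyLine_le_of_support_of_le_two {p : ℝ≥0∞} (hp : 1 < p)
    (hp2 : p ≤ 2) :
    ∃ C : ℝ≥0, ∀ (w : ℝ → ℂ) (R : ℝ), Integrable w → (∀ l, R < |l| → w l = 0) →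
      ∀ y : ℝ, 0 < y → eLpNorm (cauchyLine y w) p ≤ C * eLpNorm w p := by
  obtain ⟨C, hC⟩ := exists_eLpNorm_cauchyIntegral_le_of_nonneg hp hp2
  refine ⟨4 * C, fun w R hw hsupp y hy => ?_⟩
  have hpart : ∀ v : ℝ → ℝ, Integrable v → (∀ l, |v l| ≤ ‖w l‖) → ∃ V : ℝ → ℂ,
      (V = fun l => ((max (v l) 0 : ℝ) : ℂ)) ∧ Integrable V ∧ MemLp (cauchyLine y V) p ∧
        eLpNorm (cauchyLine y V) p ≤ C * eLpNorm w p := by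
    intro v hv hvw
    have hs : ∀ l, R < |l| → max (v l) 0 = 0 := fun l hl => by
      have := hvw l
      rw [hsupp l hl, norm_zero, abs_nonpos_iff] at this
      simp [this]
    refine ⟨_, rfl, hv.pos_part.ofReal, memLp_cauchyIntegral_of_support (R := R) hv.pos_part.ofReal
      (fun l hl => by simp [hs l hl]) hy hp, (hC (fun l => max (v l) 0) R
        (fun l => le_max_right _ _) hv.pos_part hs y hy).trans ?_⟩
    gcongr
    refine eLpNorm_mono fun l => ?_
    rw [Real.norm_of_nonneg (le_max_right _ _)]
    exact (max_le (le_abs_self _) (abs_nonneg _)).trans (hvw l)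
  have hre : Integrable fun l => (w l).re := hw.re
  have him : Integrable fun l => (w l).im := hw.im
  obtain ⟨a, ha0, hai, ha, ha'⟩ := hpart (fun l => (w l).re) hre fun l => Complex.abs_re_le_norm _
  obtain ⟨b, hb0, hbi, hb, hb'⟩ := hpart (fun l => -(w l).re) hre.neg fun l => by
    simpa using Complex.abs_re_le_norm (w l)
  obtain ⟨c, hc0, hci, hc, hc'⟩ := hpart (fun l => (w l).im) him fun l => Complex.abs_im_le_norm _
  obtain ⟨d, hd0, hdi, hd, hd'⟩ := hpart (fun l => -(w l).im) him.neg fun l => by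
    simpa using Complex.abs_im_le_norm (w l)
  have hdecomp : w = (a + (-1 : ℂ) • b) + Complex.I • (c + (-1 : ℂ) • d) := by
    funext l
    rw [ha0, hb0, hc0, hd0]
    apply Complex.ext
    · simp [← sub_eq_add_neg]
    · simp [← sub_eq_add_neg]
  have hline : cauchyLine y w = (cauchyLine y a + (-1 : ℂ) • cauchyLine y b) +
      Complex.I • (cauchyLine y c + (-1 : ℂ) • cauchyLine y d) := by
    conv_lhs => rw [hdecomp]
    rw [cauchyLine_add (hai.add (hbi.smul _)) ((hci.add (hdi.smul _)).smul _) hy,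
      cauchyLine_const_smul, cauchyLine_add hai (hbi.smul _) hy,
      cauchyLine_add hci (hdi.smul _) hy, cauchyLine_const_smul, cauchyLine_const_smul]
  have hsum : ∀ f g : ℝ → ℂ, MemLp f p → MemLp g p → ∀ ε : ℂ, ‖ε‖ₑ = 1 →
      eLpNorm (f + ε • g) p ≤ eLpNorm f p + eLpNorm g p := fun f g hf hg ε hε => by
    refine (eLpNorm_add_le hf.1 (hg.1.const_smul ε) hp.le).trans_eq ?_
    rw [eLpNorm_const_smul, hε, one_mul]
  rw [hline]
  have h1 := hsum _ _ ha hb (-1) (by simp)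
  have h2 := hsum _ _ hc hd (-1) (by simp)
  have h3 := hsum _ _ (ha.add (hb.const_smul (-1 : ℂ))) (hc.add (hd.const_smul (-1 : ℂ)))
    Complex.I (by simp [enorm_eq_nnnorm])
  have h4 : ((4 * C : ℝ≥0) : ℝ≥0∞) * eLpNorm w p =
      (C * eLpNorm w p + C * eLpNorm w p) + (C * eLpNorm w p + C * eLpNorm w p) := by
    rw [ENNReal.coe_mul, mul_assoc, ← two_mul, ← two_mul, ← mul_assoc (2 : ℝ≥0∞) 2]
    norm_num
  rw [h4]
  exact h3.trans (add_le_add (h1.trans (add_le_add ha' hb')) (h2.trans (add_le_add hc' hd')))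

/-- A bound for the Cauchy integrals of functions of bounded support extends to all of `L^p`. -/
theorem eLpNorm_cauchyLine_le_of_forall_support {p : ℝ≥0∞} (hp : 1 < p) (hpt : p ≠ ⊤)
    {C : ℝ≥0} {y : ℝ} (hy : 0 < y)
    (h : ∀ (w : ℝ → ℂ) (R : ℝ), Integrable w → (∀ l, R < |l| → w l = 0) →
      eLpNorm (cauchyLine y w) p ≤
        C * eLpNorm w p)
    {w : ℝ → ℂ} (hw : MemLp w p) :
    eLpNorm (cauchyLine y w) p ≤
      C * eLpNorm w p := by
  set W : ℕ → ℝ → ℂ := fun n => (Icc (-(n : ℝ)) n).indicator w with hW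
  have hWL : ∀ n, MemLp (W n) p := fun n => hw.indicator measurableSet_Icc
  have hWi : ∀ n, Integrable (W n) := fun n => by
    rw [hW, integrable_indicator_iff measurableSet_Icc, IntegrableOn, ← memLp_one_iff_integrable]
    exact (hw.restrict _).mono_exponent hp.le
  have hWs : ∀ n : ℕ, ∀ l : ℝ, (n : ℝ) < |l| → W n l = 0 := fun n l hl =>
    indicator_of_notMem (s := Icc (-(n : ℝ)) n) (fun hmem => hl.not_ge (abs_le.2 hmem)) _
  have hWle : ∀ n l, ‖W n l‖ ≤ ‖w l‖ := fun n l => norm_indicator_le_norm_self _ _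
  have hz : ∀ x : ℝ, 0 < (x + y * Complex.I : ℂ).im := fun x => by simpa using hy
  have hlim : ∀ x : ℝ, Tendsto (fun n : ℕ =>
      ∫ l : ℝ, (1 / ((x + y * Complex.I : ℂ) - (l : ℂ))) • W n l) atTop
      (𝓝 (∫ l : ℝ, (1 / ((x + y * Complex.I : ℂ) - (l : ℂ))) • w l)) := by
    intro x
    refine tendsto_integral_of_dominated_convergence
      (fun l => ‖(1 / ((x + y * Complex.I : ℂ) - (l : ℂ))) • w l‖)
      (fun n => (continuous_cauchyKernel (hz x)).aestronglyMeasurable.smul (hWL n).1)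
      (integrable_cauchyKernel_smul hp hpt hw (hz x)).norm
      (fun n => ae_of_all _ fun l => ?_) (ae_of_all _ fun l => ?_)
    · rw [norm_smul, norm_smul]
      gcongr
      exact hWle n l
    · refine Tendsto.const_smul (tendsto_const_nhds.congr' ?_) _
      obtain ⟨N, hN⟩ := exists_nat_ge |l|
      filter_upwards [eventually_ge_atTop N] with n hn
      refine (indicator_of_mem ?_ _).symm
      exact abs_le.1 (hN.trans (by exact_mod_cast hn))
  -- Fatou: the truncated integrals converge at every point, and their norms are bounded by `C`
  -- times the norm of `w`.
  refine (Lp.eLpNorm_lim_le_liminf_eLpNorm (fun n =>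
    (memLp_cauchyIntegral_of_support (hWi n) (hWs n) hy hp).1) _ (ae_of_all _ hlim)).trans ?_
  refine (liminf_le_liminf (v := fun _ : ℕ => C * eLpNorm w p)
    (Eventually.of_forall fun n => ?_)).trans (liminf_const _).le
  refine (h (W n) n (hWi n) (hWs n)).trans ?_
  gcongr
  exact eLpNorm_mono (hWle n)

/-- Fubini's theorem for the bilinear form of the Cauchy kernel on a horizontal line. -/
theorem integral_cauchyLine_mul {w g : ℝ → ℂ} (hw : Integrable w) (hg : Integrable g) {y : ℝ}
    (hy : 0 < y) :
    ∫ x, cauchyLine y w x * g x =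
      ∫ l, w l * ∫ x : ℝ, (1 / ((x + y * Complex.I : ℂ) - (l : ℂ))) * g x := by
  have hz : ∀ x : ℝ, 0 < (x + y * Complex.I : ℂ).im := fun x => by simpa using hy
  have hk : Continuous fun q : ℝ × ℝ => 1 / ((q.1 + y * Complex.I : ℂ) - (q.2 : ℂ)) :=
    continuous_const.div (by fun_prop) fun q => sub_ofReal_ne_zero (hz q.1) q.2
  have hint : Integrable (fun q : ℝ × ℝ =>
      (1 / ((q.1 + y * Complex.I : ℂ) - (q.2 : ℂ))) • (g q.1 * w q.2))
      (volume.prod volume) := by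
    refine (hg.mul_prod hw).bdd_smul (1 / y) hk.aestronglyMeasurable (ae_of_all _ fun q => ?_)
    rw [norm_div, norm_one]
    refine one_div_le_one_div_of_le hy ?_
    simpa using im_le_norm_sub_ofReal (q.1 + y * Complex.I : ℂ) q.2
  calc ∫ x, cauchyLine y w x * g x
      = ∫ x : ℝ, ∫ l : ℝ, (1 / ((x + y * Complex.I : ℂ) - (l : ℂ))) • (g x * w l) := by
        refine integral_congr_ae (ae_of_all _ fun x => ?_)
        simp only [cauchyLine]
        rw [← integral_mul_const]
        refine integral_congr_ae (ae_of_all _ fun l => ?_)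
        simp only [smul_eq_mul]
        ring
    _ = ∫ l : ℝ, ∫ x : ℝ, (1 / ((x + y * Complex.I : ℂ) - (l : ℂ))) • (g x * w l) :=
        integral_integral_swap hint
    _ = _ := by
        refine integral_congr_ae (ae_of_all _ fun l => ?_)
        simp only
        rw [← integral_const_mul]
        refine integral_congr_ae (ae_of_all _ fun x => ?_)
        simp only [smul_eq_mul]
        ring

/-- The transpose of the Cauchy integral on a horizontal line. -/
theorem integral_cauchyKernel_mul_eq (g : ℝ → ℂ) (y l : ℝ) :
    ∫ x : ℝ, (1 / ((x + y * Complex.I : ℂ) - (l : ℂ))) * g x =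
      -(starRingEnd ℂ) (cauchyLine y (fun x => (starRingEnd ℂ) (g x)) l) := by
  rw [cauchyLine, ← integral_conj, ← integral_neg]
  refine integral_congr_ae (ae_of_all _ fun x => ?_)
  simp only [smul_eq_mul, map_mul, Complex.conj_conj, map_div₀, map_one, map_sub, map_add,
    Complex.conj_ofReal, Complex.conj_I]
  rw [← neg_mul, ← div_neg]
  congr 2
  ring

/-- Duality: `f = cauchyLine y w` is paired with its extremal function `g = ‖f‖^{r-2} conj f`, the
operator is moved onto `g`, and the bound in the conjugate exponent `s` is used. -/
theorem eLpNorm_cauchyLine_le_of_holderConjugate {r s : ℝ} (hrs : r.HolderConjugate s)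
    (hr : 2 < r) {C : ℝ≥0} {y : ℝ} (hy : 0 < y)
    (hC : ∀ g : ℝ → ℂ, MemLp g (ENNReal.ofReal s) →
      eLpNorm (cauchyLine y g) (ENNReal.ofReal s) ≤ C * eLpNorm g (ENNReal.ofReal s))
    {w : ℝ → ℂ} {R : ℝ} (hw : Integrable w) (hsupp : ∀ l, R < |l| → w l = 0) :
    eLpNorm (cauchyLine y w) (ENNReal.ofReal r) ≤ C * eLpNorm w (ENNReal.ofReal r) := by
  have hr0 : 0 < r := by linarith
  have hs0 : 0 < s := hrs.symm.pos
  have hsr : (r - 1) * s = r := hrs.sub_one_mul_conj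
  have hor : ENNReal.ofReal r ≠ 0 := by simpa using hr0
  have hos : ENNReal.ofReal s ≠ 0 := by simpa using hs0
  set f := cauchyLine y w with hf
  have hfL : ∀ t : ℝ, 1 < t → MemLp f (ENNReal.ofReal t) := fun t ht =>
    memLp_cauchyLine_of_support hw hsupp hy (by simpa using ht)
  set g : ℝ → ℂ := fun x => ((‖f x‖ ^ (r - 2) : ℝ) : ℂ) * (starRingEnd ℂ) (f x) with hg
  have hfm : AEMeasurable f := (hfL r (by linarith)).1.aemeasurable
  have hgm : AEStronglyMeasurable g :=
    ((hfm.norm.pow_const _).complex_ofReal.mul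
      (Complex.continuous_conj.measurable.comp_aemeasurable hfm)).aestronglyMeasurable
  have hgn : ∀ x, ‖g x‖ = ‖f x‖ ^ (r - 1) := by
    intro x
    rw [hg, norm_mul, Complex.norm_real, RCLike.norm_conj,
      Real.norm_of_nonneg (Real.rpow_nonneg (norm_nonneg _) _),
      ← Real.rpow_add_one' (norm_nonneg _) (by linarith)]
    congr 1
    ring
  have hfg : ∀ x, f x * g x = ((‖f x‖ ^ r : ℝ) : ℂ) := by
    intro x
    have h1 : f x * g x = ((‖f x‖ ^ (r - 2) * ‖f x‖ ^ 2 : ℝ) : ℂ) := by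
      rw [hg, mul_left_comm, Complex.mul_conj']
      push_cast
      rfl
    rw [h1, ← Real.rpow_natCast, ← Real.rpow_add' (norm_nonneg _) (by push_cast; linarith)]
    congr 2
    push_cast
    ring
  -- Fubini needs `g ∈ L^1`, i.e. `f ∈ L^{r-1}`. This is known because `r - 1 > 1`, which is where
  -- `r > 2` enters.
  have hgi : Integrable g := by
    have h1 : 1 < r - 1 := by linarith
    have h2 := (hfL (r - 1) h1).integrable_norm_rpow (by simp; linarith) ENNReal.ofReal_ne_top
    rw [ENNReal.toReal_ofReal (by linarith)] at h2
    exact h2.mono' hgm (ae_of_all _ fun x => (hgn x).le)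
  set X := ∫⁻ x, ‖f x‖ₑ ^ r with hX
  have hXt : X ≠ ⊤ := by
    have := lintegral_rpow_enorm_lt_top_of_eLpNorm_lt_top hor ENNReal.ofReal_ne_top
      (hfL r (by linarith)).2
    rw [ENNReal.toReal_ofReal hr0.le] at this
    exact this.ne
  have hgX : eLpNorm g (ENNReal.ofReal s) = X ^ (1 / s) := by
    rw [eLpNorm_eq_lintegral_rpow_enorm_toReal hos ENNReal.ofReal_ne_top,
      ENNReal.toReal_ofReal hs0.le]
    congr 1
    refine lintegral_congr fun x => ?_
    rw [← ofReal_norm, hgn, ← ENNReal.ofReal_rpow_of_nonneg (norm_nonneg _) (by linarith),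
      ofReal_norm, ← ENNReal.rpow_mul, hsr]
  have hconj : ∀ x, ‖(starRingEnd ℂ) (g x)‖ = ‖g x‖ := fun x => RCLike.norm_conj _
  have hgc : eLpNorm (fun x => (starRingEnd ℂ) (g x)) (ENNReal.ofReal s) = X ^ (1 / s) := by
    rw [← hgX]
    exact eLpNorm_congr_norm_ae (ae_of_all _ hconj)
  have hgcL : MemLp (fun x => (starRingEnd ℂ) (g x)) (ENNReal.ofReal s) :=
    ⟨(Complex.continuous_conj.measurable.comp_aemeasurable hgm.aemeasurable).aestronglyMeasurable,
      by rw [hgc]; exact (ENNReal.rpow_lt_top_of_nonneg (by positivity) hXt)⟩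
  set h : ℝ → ℂ := cauchyLine y (fun x => (starRingEnd ℂ) (g x)) with hh
  have hhm : AEStronglyMeasurable h := by
    have hd := differentiableOn_cauchyIntegral hgcL.1 fun z hz => by
      refine integrable_cauchyKernel_smul_of_integrable ?_ hz
      exact hgi.norm.mono' hgcL.1 (ae_of_all _ fun x => (hconj x).le)
    refine Continuous.aestronglyMeasurable ?_
    exact hd.continuousOn.comp_continuous (f := fun x : ℝ => (x + y * Complex.I : ℂ))
      (by fun_prop) fun x => by simpa [upperHalf] using hy
  have hXle : X ≤ eLpNorm w (ENNReal.ofReal r) * (C * X ^ (1 / s)) := by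
    have hint : Integrable fun x => ‖f x‖ ^ r := by
      have := (hfL r (by linarith)).integrable_norm_rpow hor ENNReal.ofReal_ne_top
      rwa [ENNReal.toReal_ofReal hr0.le] at this
    have h1 : X = ‖∫ x, f x * g x‖ₑ := by
      simp only [hfg]
      rw [integral_complex_ofReal, ← ofReal_norm, Complex.norm_real, Real.norm_of_nonneg
        (integral_nonneg fun x => by positivity),
        ofReal_integral_eq_lintegral_ofReal hint (ae_of_all _ fun x => by positivity)]
      refine lintegral_congr fun x => ?_
      rw [← ENNReal.ofReal_rpow_of_nonneg (norm_nonneg _) hr0.le, ofReal_norm]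
    calc X = ‖∫ l, w l * ∫ x : ℝ, (1 / ((x + y * Complex.I : ℂ) - (l : ℂ))) * g x‖ₑ := by
          rw [h1, integral_cauchyLine_mul hw hgi hy]
      _ ≤ ∫⁻ l, ‖w l * ∫ x : ℝ, (1 / ((x + y * Complex.I : ℂ) - (l : ℂ))) * g x‖ₑ :=
          enorm_integral_le_lintegral_enorm _
      _ = ∫⁻ l, ((fun l => ‖w l‖ₑ) * fun l => ‖h l‖ₑ) l := by
          refine lintegral_congr fun l => ?_
          rw [integral_cauchyKernel_mul_eq, enorm_mul, enorm_neg, RCLike.enorm_conj]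
          rfl
      _ ≤ (∫⁻ l, ‖w l‖ₑ ^ r) ^ (1 / r) * (∫⁻ l, ‖h l‖ₑ ^ s) ^ (1 / s) :=
          ENNReal.lintegral_mul_le_Lp_mul_Lq volume hrs hw.aestronglyMeasurable.enorm hhm.enorm
      _ = eLpNorm w (ENNReal.ofReal r) * eLpNorm h (ENNReal.ofReal s) := by
          rw [eLpNorm_eq_lintegral_rpow_enorm_toReal hor ENNReal.ofReal_ne_top,
            eLpNorm_eq_lintegral_rpow_enorm_toReal hos ENNReal.ofReal_ne_top,
            ENNReal.toReal_ofReal hr0.le, ENNReal.toReal_ofReal hs0.le]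
      _ ≤ _ := by
          gcongr
          rw [← hgc]
          exact hC _ hgcL
  rw [eLpNorm_eq_lintegral_rpow_enorm_toReal hor ENNReal.ofReal_ne_top,
    ENNReal.toReal_ofReal hr0.le, ← hX]
  rcases eq_or_ne X 0 with h0 | h0
  · rw [h0, ENNReal.zero_rpow_of_pos (by positivity)]
    exact zero_le
  -- The bound `X ≤ ‖w‖_r C X^{1/s}` may be divided by `X^{1/s}` since `X` is finite a priori; what
  -- remains is `X^{1/r}`.
  have hY0 : X ^ (1 / s) ≠ 0 := by
    simp [h0, hXt, ENNReal.rpow_eq_zero_iff]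
  have hYt : X ^ (1 / s) ≠ ⊤ := (ENNReal.rpow_lt_top_of_nonneg (by positivity) hXt).ne
  rw [← ENNReal.mul_le_mul_iff_left hY0 hYt, ← ENNReal.rpow_add _ _ h0 hXt]
  have : 1 / r + 1 / s = 1 := by
    rw [one_div, one_div, hrs.inv_add_inv_eq_one]
  rw [this, ENNReal.rpow_one]
  calc X ≤ _ := hXle
    _ = _ := by ring

/-- **The M. Riesz inequality** for Cauchy integrals in the upper half-plane. -/
theorem exists_eLpNorm_cauchyLine_le {p : ℝ≥0∞} (hp : 1 < p) (hpt : p ≠ ⊤) :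
    ∃ C : ℝ≥0, ∀ w : ℝ → ℂ, MemLp w p → ∀ y : ℝ, 0 < y →
      eLpNorm (cauchyLine y w) p ≤ C * eLpNorm w p := by
  have hle : ∀ p : ℝ≥0∞, 1 < p → p ≤ 2 → ∃ C : ℝ≥0, ∀ w : ℝ → ℂ, MemLp w p → ∀ y : ℝ, 0 < y →
      eLpNorm (cauchyLine y w) p ≤ C * eLpNorm w p := fun p hp hp2 => by
    obtain ⟨C, hC⟩ := exists_eLpNorm_cauchyLine_le_of_support_of_le_two hp hp2
    exact ⟨C, fun w hw y hy => eLpNorm_cauchyLine_le_of_forall_support hp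
      (hp2.trans_lt (by simp)).ne hy (fun w R hi hs => hC w R hi hs y hy) hw⟩
  rcases le_or_gt p 2 with h2 | h2
  · exact hle p hp h2
  have hr : 2 < p.toReal := by
    simpa using (ENNReal.toReal_lt_toReal (by simp) hpt).2 h2
  have hrs := Real.HolderConjugate.conjExponent (by linarith : 1 < p.toReal)
  set r := p.toReal
  set s := r.conjExponent with hs
  have hs2 : s ≤ 2 := by
    rw [hs, Real.conjExponent, div_le_iff₀ (by linarith)]
    linarith
  have hpr : p = ENNReal.ofReal r := (ENNReal.ofReal_toReal hpt).symm
  obtain ⟨C, hC⟩ := hle (ENNReal.ofReal s) (by simpa using hrs.symm.lt)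
    (by simpa using ENNReal.ofReal_le_ofReal hs2)
  refine ⟨C, fun w hw y hy => eLpNorm_cauchyLine_le_of_forall_support hp hpt hy
    (fun w R hi hsupp => ?_) hw⟩
  rw [hpr]
  exact eLpNorm_cauchyLine_le_of_holderConjugate hrs hr hy (fun g hg => hC g hg y hy) hi hsupp

end RieszInequality

/-! ### Hardy placement of Cauchy transforms -/

section Hardy

variable {E : Type*} [NormedAddCommGroup E] [NormedSpace ℂ E]

/-- The Cauchy transform of an `L^p` density with values in a finite-dimensional space is in the
Hardy space `H^p`, for `1 < p < ∞`. -/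
theorem IsCauchyTransform.memHardy [FiniteDimensional ℂ E] {w : ℝ → E} {F : ℂ → E}
    (hF : IsCauchyTransform w F) {p : ℝ≥0∞} (hp : 1 < p) (hpt : p ≠ ⊤) (hw : MemLp w p) :
    MemHardy p F := by
  have : CompleteSpace E := FiniteDimensional.complete ℂ E
  refine ⟨(differentiableOn_cauchyIntegral hw.1 fun z hz =>
    integrable_cauchyKernel_smul hp hpt hw hz).congr hF, ?_⟩
  obtain ⟨C, hC⟩ := exists_eLpNorm_cauchyLine_le hp hpt
  set b := Module.finBasis ℂ E with hb
  set φ : Fin (Module.finrank ℂ E) → E →L[ℂ] ℂ := fun i => LinearMap.toContinuousLinearMap (b.coord i)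
    with hφ
  have hφw : ∀ i, MemLp (fun l => φ i (w l)) p := fun i => (φ i).comp_memLp' hw
  have hline : ∀ y : ℝ, 0 < y → (fun x : ℝ => F ((x : ℂ) + (y : ℂ) * Complex.I)) =
      ∑ i, fun x => cauchyLine y (fun l => φ i (w l)) x • b i := by
    intro y hy
    funext x
    have hz : 0 < (x + y * Complex.I : ℂ).im := by simpa using hy
    have hco : ∀ i, cauchyLine y (fun l => φ i (w l)) x = b.coord i (F (x + y * Complex.I)) := by
      intro i
      rw [hF _ hz, cauchyLine]
      have := (φ i).integral_comp_comm (integrable_cauchyKernel_smul hp hpt hw hz)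
      simp only [map_smul] at this
      exact this
    rw [Finset.sum_apply]
    simp only [hco, Module.Basis.coord_apply]
    exact (b.sum_repr _).symm
  have hcont : ∀ y : ℝ, 0 < y → ∀ i,
      Continuous fun x => cauchyLine y (fun l => φ i (w l)) x := fun y hy i =>
    (differentiableOn_cauchyIntegral (hφw i).1 fun z hz =>
      integrable_cauchyKernel_smul hp hpt (hφw i) hz).continuousOn.comp_continuous
      (f := fun x : ℝ => (x + y * Complex.I : ℂ)) (by fun_prop)
      fun x => by simpa [upperHalf] using hy
  have hle : hardyNorm p F ≤ ∑ i, C * eLpNorm (fun l => φ i (w l)) p * ‖b i‖ₑ := by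
    refine iSup₂_le fun y hy => ?_
    rw [hline y hy]
    refine (eLpNorm_sum_le (fun i _ =>
      ((hcont y hy i).smul continuous_const).aestronglyMeasurable) hp.le).trans ?_
    refine Finset.sum_le_sum fun i _ => ?_
    have h1 : eLpNorm (fun x => cauchyLine y (fun l => φ i (w l)) x • b i) p ≤
        eLpNorm (fun x => ‖b i‖ • cauchyLine y (fun l => φ i (w l)) x) p :=
      eLpNorm_mono fun x => by simp [norm_smul, mul_comm]
    refine h1.trans ?_
    have h2 := eLpNorm_const_smul (‖b i‖) (fun x => cauchyLine y (fun l => φ i (w l)) x) p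
      (volume : Measure ℝ)
    refine h2.le.trans ?_
    rw [enorm_norm, mul_comm]
    gcongr
    exact hC _ (hφw i) y hy
  refine hle.trans_lt (ENNReal.sum_lt_top.2 fun i _ => ?_)
  exact ENNReal.mul_lt_top (ENNReal.mul_lt_top ENNReal.coe_lt_top (hφw i).2) enorm_lt_top

/-- Interpolation between `L^1` and `L^q`. -/
theorem memLp_of_memLp_one {α : Type*} [MeasurableSpace α] {μ : Measure α}
    {G : Type*} [NormedAddCommGroup G] {w : α → G} {p q : ℝ≥0∞}
    (h1 : MemLp w 1 μ) (hq : MemLp w q μ) (hp : 1 < p) (hpq : p ≤ q) (hpt : p ≠ ⊤) :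
    MemLp w p μ := by
  have hp0 : p ≠ 0 := (zero_lt_one.trans hp).ne'
  have hi : Integrable (fun x => ‖w x‖) μ := (memLp_one_iff_integrable.1 h1).norm
  have hr : 1 < p.toReal := by
    simpa using (ENNReal.toReal_lt_toReal ENNReal.one_ne_top hpt).2 hp
  rw [← integrable_norm_rpow_iff h1.1 hp0 hpt]
  have hm : AEStronglyMeasurable (fun x => ‖w x‖ ^ p.toReal) μ :=
    (h1.1.norm.aemeasurable.pow_const _).aestronglyMeasurable
  rcases eq_or_ne q ⊤ with rfl | hqt
  · set M := (eLpNormEssSup w μ).toReal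
    have hM : ∀ᵐ x ∂μ, ‖w x‖ ≤ M := by
      have hlt : eLpNormEssSup w μ < ⊤ := by simpa using hq.2
      filter_upwards [ae_le_eLpNormEssSup (f := w) (μ := μ)] with x hx
      rw [← toReal_enorm]
      exact ENNReal.toReal_mono hlt.ne hx
    refine (hi.const_mul (M ^ (p.toReal - 1))).mono' hm ?_
    filter_upwards [hM] with x hx
    rw [Real.norm_of_nonneg (by positivity)]
    calc ‖w x‖ ^ p.toReal = ‖w x‖ ^ (p.toReal - 1) * ‖w x‖ := by
          rw [← Real.rpow_add_one' (norm_nonneg _) (by linarith), sub_add_cancel]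
      _ ≤ M ^ (p.toReal - 1) * ‖w x‖ := by
          gcongr
  · have hpq' : p.toReal ≤ q.toReal := ENNReal.toReal_mono hqt hpq
    refine (hi.add (hq.integrable_norm_rpow (hp0.bot_lt.trans_le hpq).ne' hqt)).mono' hm
      (ae_of_all _ fun x => ?_)
    rw [Real.norm_of_nonneg (by positivity)]
    have h0 := norm_nonneg (w x)
    simp only [Pi.add_apply]
    rcases le_total ‖w x‖ 1 with h | h
    · have : ‖w x‖ ^ p.toReal ≤ ‖w x‖ := by
        simpa using Real.rpow_le_rpow_of_exponent_ge' h0 h zero_le_one hr.le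
      have := Real.rpow_nonneg h0 q.toReal
      linarith
    · have := Real.rpow_le_rpow_of_exponent_le h hpq'
      linarith

end Hardy

/-! ### Power-law singularities -/

section SubOhmic

variable {E : Type*} [NormedAddCommGroup E]

theorem integrableOn_abs_rpow {a δ : ℝ} (ha : -1 < a) (hδ : 0 ≤ δ) :
    IntegrableOn (fun x : ℝ => |x| ^ a) (Ioo (-δ) δ) := by
  have h1 : IntervalIntegrable (fun x : ℝ => |x| ^ a) volume 0 δ := by
    refine (intervalIntegral.intervalIntegrable_rpow' ha).congr ?_
    intro x hx
    rw [uIoc_of_le hδ] at hx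
    simp only [abs_of_pos hx.1]
  exact (intervalIntegrable_iff_integrableOn_Ioo_of_le (by linarith)).1
    (intervalIntegrable_of_even (fun x => by simp [abs_neg]) (fun t ht =>
      (intervalIntegral.intervalIntegrable_rpow' ha).congr (fun x hx => by
        rw [uIoc_of_le ht.le] at hx
        simp only [abs_of_pos hx.1])) )

theorem exists_forall_norm_le_of_isBigO_nhdsNE {G H : Type*} [Norm G] [SeminormedAddCommGroup H]
    {f : ℝ → G} {g : ℝ → H} (h : f =O[𝓝[≠] 0] g) :
    ∃ C δ : ℝ, 0 < C ∧ 0 < δ ∧ ∀ l : ℝ, l ≠ 0 → |l| < δ → ‖f l‖ ≤ C * ‖g l‖ := by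
  obtain ⟨C, hC, hb⟩ := h.exists_pos
  rw [IsBigOWith, eventually_nhdsWithin_iff, Metric.eventually_nhds_iff] at hb
  obtain ⟨δ, hδ, hb⟩ := hb
  exact ⟨C, δ, hC, hδ, fun l hl hlδ => hb (by simpa using hlδ) hl⟩

theorem mul_toReal_lt_of_lt_ofReal {s : ℝ} (hs : s < 1) {p : ℝ≥0∞}
    (hp : p < ENNReal.ofReal (1 / (1 - s))) : -1 < (s - 1) * p.toReal := by
  have h1 : p.toReal < 1 / (1 - s) := by
    have := (ENNReal.toReal_lt_toReal (hp.trans ENNReal.ofReal_lt_top).ne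
      ENNReal.ofReal_ne_top).2 hp
    rwa [ENNReal.toReal_ofReal (one_div_nonneg.2 (by linarith))] at this
  rw [lt_div_iff₀ (by linarith)] at h1
  linarith

/-- Split at `|l| = δ`: inside, comparison with `|l|^{s-1}`, whose `p`-th power has exponent above
`-1`; outside, the hypothesis. -/
theorem memLp_of_isBigO_rpow {s : ℝ} (hs : s < 1) {w : ℝ → E} (hm : AEStronglyMeasurable w)
    (hO : (fun l : ℝ => ‖w l‖) =O[𝓝[≠] 0] (fun l : ℝ => |l| ^ (s - 1))) {p : ℝ≥0∞} (hp0 : p ≠ 0)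
    (haway : ∀ δ : ℝ, 0 < δ → MemLp w p (volume.restrict {l : ℝ | δ ≤ |l|}))
    (hp : p < ENNReal.ofReal (1 / (1 - s))) : MemLp w p := by
  have hpt : p ≠ ⊤ := (hp.trans ENNReal.ofReal_lt_top).ne
  obtain ⟨C, δ, hC, hδ, hb⟩ := exists_forall_norm_le_of_isBigO_nhdsNE hO
  have hpow : MemLp (fun l : ℝ => |l| ^ (s - 1)) p (volume.restrict (Ioo (-δ) δ)) := by
    have hmeas : Measurable fun l : ℝ => |l| ^ (s - 1) := by fun_prop
    rw [← integrable_norm_rpow_iff hmeas.aestronglyMeasurable hp0 hpt]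
    refine (integrableOn_abs_rpow (mul_toReal_lt_of_lt_ofReal hs hp) hδ.le).congr
      (ae_of_all _ fun l => ?_)
    simp only
    rw [Real.norm_of_nonneg (by positivity), ← Real.rpow_mul (abs_nonneg _)]
  have hnear : MemLp w p (volume.restrict (Ioo (-δ) δ)) := by
    refine hpow.of_le_mul (c := C) hm.restrict ?_
    have h0 : ∀ᵐ l : ℝ ∂(volume.restrict (Ioo (-δ) δ)), l ≠ 0 :=
      ae_restrict_of_ae (Measure.ae_ne volume 0)
    filter_upwards [h0, ae_restrict_mem measurableSet_Ioo] with l hl hmem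
    simpa using hb l hl (abs_lt.2 hmem)
  have hcompl : (Ioo (-δ) δ)ᶜ = {l : ℝ | δ ≤ |l|} := by
    ext l
    simp only [mem_compl_iff, mem_Ioo, mem_ofPred_eq, ← abs_lt, not_lt]
  have hfar := haway δ hδ
  rw [← hcompl] at hfar
  rw [← indicator_self_add_compl (Ioo (-δ) δ) w]
  exact ((memLp_indicator_iff_restrict measurableSet_Ioo).2 hnear).add
    ((memLp_indicator_iff_restrict measurableSet_Ioo.compl).2 hfar)

/-- On an interval `(0, δ)` of finite measure a larger exponent implies the critical one, where the
`p`-th power of `l^{s-1}` is the non-integrable `l^{-1}`. -/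
theorem lt_ofReal_of_memLp_of_isBigO_rpow {s : ℝ} (hs : s < 1) {w : ℝ → E}
    (hO : (fun l : ℝ => |l| ^ (s - 1)) =O[𝓝[≠] 0] (fun l : ℝ => ‖w l‖)) {p : ℝ≥0∞}
    (hw : MemLp w p) : p < ENNReal.ofReal (1 / (1 - s)) := by
  by_contra! hle
  have hr : 0 < 1 / (1 - s) := one_div_pos.2 (by linarith)
  obtain ⟨C, δ, hC, hδ, hb⟩ := exists_forall_norm_le_of_isBigO_nhdsNE hO
  have hw' : MemLp w (ENNReal.ofReal (1 / (1 - s))) (volume.restrict (Ioo 0 δ)) :=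
    (hw.restrict _).mono_exponent hle
  have hmeas : Measurable fun l : ℝ => |l| ^ (s - 1) := by fun_prop
  have hpow : MemLp (fun l : ℝ => |l| ^ (s - 1)) (ENNReal.ofReal (1 / (1 - s)))
      (volume.restrict (Ioo 0 δ)) := by
    refine hw'.of_le_mul (c := C) hmeas.aestronglyMeasurable ?_
    filter_upwards [ae_restrict_mem measurableSet_Ioo] with l hl
    have := hb l hl.1.ne' (by rw [abs_of_pos hl.1]; exact hl.2)
    rwa [norm_norm] at this
  have hint := hpow.integrable_norm_rpow (by simpa using hr) ENNReal.ofReal_ne_top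
  rw [ENNReal.toReal_ofReal hr.le] at hint
  have : IntegrableOn (fun x : ℝ => x ^ (-1 : ℝ)) (Ioo 0 δ) := by
    refine hint.congr ?_
    filter_upwards [ae_restrict_mem measurableSet_Ioo] with l hl
    rw [Real.norm_of_nonneg (by positivity), abs_of_pos hl.1, ← Real.rpow_mul hl.1.le]
    congr 1
    have : 1 - s ≠ 0 := by linarith
    field_simp
    ring
  exact absurd ((intervalIntegral.integrableOn_Ioo_rpow_iff hδ).1 this) (lt_irrefl _)

end SubOhmic

/-! ### Bath power spectra -/

section Baths

theorem memLp_inv_one_add_abs_sq {p : ℝ≥0∞} (hp : 1 ≤ p) :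
    MemLp (fun x : ℝ => ((1 + |x|)⁻¹) ^ 2) p := by
  have hc : Continuous fun x : ℝ => ((1 + |x|)⁻¹) ^ 2 :=
    (Continuous.inv₀ (by fun_prop) fun x => by positivity).pow 2
  rcases hp.eq_or_lt with rfl | hp
  · rw [memLp_one_iff_integrable]
    refine (integrable_one_add_norm (E := ℝ) (r := 2) (by simp)).congr (ae_of_all _ fun x => ?_)
    simp only [Real.norm_eq_abs]
    rw [Real.rpow_neg (by positivity), inv_pow]
    norm_num
  · refine (memLp_inv_one_add_abs hp).of_le hc.aestronglyMeasurable (ae_of_all _ fun x => ?_)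
    rw [Real.norm_of_nonneg (by positivity), Real.norm_of_nonneg (by positivity)]
    exact pow_le_of_le_one (by positivity) (inv_le_one_of_one_le₀ (by linarith [abs_nonneg x]))
      two_ne_zero

/-- Both signs follow from `1 + x ≤ e^x`. The value at `l = 0` is the convention `0/0 = 0`. -/
theorem abs_div_one_sub_exp_neg_le {β : ℝ} (hβ : 0 < β) (l : ℝ) :
    |l / (1 - Real.exp (-β * l))| ≤ 1 / β + |l| := by
  rcases lt_trichotomy l 0 with hl | rfl | hl
  · have h1 : -β * l + 1 ≤ Real.exp (-β * l) := Real.add_one_le_exp _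
    have h2 : 0 < -β * l := by nlinarith
    rw [abs_div, abs_of_neg hl, abs_of_neg (by linarith), neg_sub]
    have : -l / (Real.exp (-β * l) - 1) ≤ 1 / β := by
      rw [div_le_div_iff₀ (by linarith) hβ]
      linarith
    linarith
  · simp [hβ.le]
  · have h1 : β * l + 1 ≤ Real.exp (β * l) := Real.add_one_le_exp _
    have h2 : 0 < β * l := by positivity
    have h3 : Real.exp (-β * l) ≤ 1 / (β * l + 1) := by
      rw [neg_mul, Real.exp_neg, ← one_div]
      exact one_div_le_one_div_of_le (by linarith) h1
    have h4 : β * l / (β * l + 1) ≤ 1 - Real.exp (-β * l) := by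
      have : β * l / (β * l + 1) = 1 - 1 / (β * l + 1) := by
        field_simp
        ring
      linarith
    have h5 : 0 < β * l / (β * l + 1) := by positivity
    rw [abs_of_pos (div_pos hl (by linarith)), abs_of_pos hl]
    calc l / (1 - Real.exp (-β * l)) ≤ l / (β * l / (β * l + 1)) := by gcongr
      _ = 1 / β + l := by
        field_simp
        ring

theorem thermalSpectrum_eq (β : ℝ) (J : ℝ → ℝ) (l : ℝ) :
    thermalSpectrum β J l = J |l| / |l| * (l / (1 - Real.exp (-β * l))) := by
  rcases eq_or_ne l 0 with rfl | hl
  · simp [thermalSpectrum]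
  · have h : ((SignType.sign l : SignType) : ℝ) = l / |l| := by
      rw [eq_div_iff (abs_ne_zero.2 hl), sign_mul_abs]
    rw [thermalSpectrum, h]
    ring

theorem measurable_thermalSpectrum (β : ℝ) {J : ℝ → ℝ} (hJ : Measurable J) :
    Measurable (thermalSpectrum β J) := by
  have : thermalSpectrum β J = fun l => J |l| / |l| * (l / (1 - Real.exp (-β * l))) :=
    funext (thermalSpectrum_eq β J)
  rw [this]
  have h : Measurable fun l : ℝ => J |l| := hJ.comp measurable_abs
  exact (h.div measurable_abs).mul (measurable_id.div (by fun_prop))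

theorem abs_thermalSpectrum_le {β : ℝ} (hβ : 0 < β) (J : ℝ → ℝ) (l : ℝ) :
    |thermalSpectrum β J l| ≤ |J (|l|)| / |l| * ((1 / β + 1) * (1 + |l|)) := by
  rw [thermalSpectrum_eq, abs_mul, abs_div, abs_abs]
  gcongr
  refine (abs_div_one_sub_exp_neg_le hβ l).trans ?_
  have : 0 < 1 / β := by positivity
  nlinarith [abs_nonneg l]

/-- The cube leaves `(1 + x)^{-2}`, still integrable, after the linear growth of the thermal factor
is absorbed. -/
theorem exp_neg_div_le {c x : ℝ} (hc : 0 < c) (hx : 0 ≤ x) :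
    Real.exp (-x / c) ≤ Real.exp (1 / c) * 6 * c ^ 3 * ((1 + x)⁻¹) ^ 3 := by
  have h1 := Real.pow_div_factorial_le_exp ((1 + x) / c) (by positivity) 3
  have h2 : Real.exp (-x / c) = Real.exp (1 / c) * (Real.exp ((1 + x) / c))⁻¹ := by
    rw [← Real.exp_neg, ← Real.exp_add]
    congr 1
    ring
  have h3 : (Real.exp ((1 + x) / c))⁻¹ ≤ (((1 + x) / c) ^ 3 / (Nat.factorial 3 : ℕ))⁻¹ :=
    inv_anti₀ (by positivity) h1
  have h4 : (((1 + x) / c) ^ 3 / (Nat.factorial 3 : ℕ))⁻¹ = 6 * c ^ 3 * ((1 + x)⁻¹) ^ 3 := by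
    norm_num [Nat.factorial]
    field_simp
  rw [h2, mul_assoc, mul_assoc, ← mul_assoc 6]
  gcongr
  exact h3.trans h4.le

theorem exists_abs_thermalSpectrum_powerLawJ_le {β η ωc : ℝ} (s : ℝ) (hβ : 0 < β)
    (hωc : 0 < ωc) : ∃ K : ℝ, 0 ≤ K ∧ ∀ l : ℝ, l ≠ 0 →
      |thermalSpectrum β (powerLawJ η ωc s) l| ≤ K * |l| ^ (s - 1) * ((1 + |l|)⁻¹) ^ 2 := by
  refine ⟨|η| / ωc ^ (s - 1) * (Real.exp (1 / ωc) * 6 * ωc ^ 3) * (1 / β + 1), by positivity,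
    fun l hl => (abs_thermalSpectrum_le hβ _ l).trans ?_⟩
  have hl0 : 0 < |l| := abs_pos.2 hl
  have hJ : |powerLawJ η ωc s (|l|)| / |l| =
      |η| / ωc ^ (s - 1) * |l| ^ (s - 1) * Real.exp (-|l| / ωc) := by
    rw [powerLawJ, abs_div, abs_mul, abs_mul, Real.abs_exp,
      abs_of_nonneg (Real.rpow_nonneg hl0.le s), abs_of_nonneg (Real.rpow_nonneg hωc.le (s - 1)),
      Real.rpow_sub_one hl0.ne' s]
    ring
  rw [hJ]
  calc |η| / ωc ^ (s - 1) * |l| ^ (s - 1) * Real.exp (-|l| / ωc) * ((1 / β + 1) * (1 + |l|))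
      ≤ |η| / ωc ^ (s - 1) * |l| ^ (s - 1) * (Real.exp (1 / ωc) * 6 * ωc ^ 3 *
        ((1 + |l|)⁻¹) ^ 3) * ((1 / β + 1) * (1 + |l|)) := by
        gcongr
        exact exp_neg_div_le hωc hl0.le
    _ = _ := by
        have : (1 + |l|)⁻¹ * (1 + |l|) = 1 := inv_mul_cancel₀ (by positivity)
        linear_combination (|η| / ωc ^ (s - 1) * |l| ^ (s - 1) *
          (Real.exp (1 / ωc) * 6 * ωc ^ 3) * (1 / β + 1) * ((1 + |l|)⁻¹) ^ 2) * this

theorem measurable_powerLawJ (η ωc s : ℝ) : Measurable (powerLawJ η ωc s) := by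
  unfold powerLawJ
  fun_prop

theorem measurable_drudeLorentzJ (Λ γ : ℝ) : Measurable (drudeLorentzJ Λ γ) := by
  unfold drudeLorentzJ
  fun_prop

theorem memLp_smul_vector {E : Type*} [NormedAddCommGroup E] [NormedSpace ℂ E] {f : ℝ → ℝ}
    {p : ℝ≥0∞} {μ : Measure ℝ} (hf : MemLp f p μ) (A : E) : MemLp (fun l => f l • A) p μ :=
  hf.of_le_mul (c := ‖A‖) (hf.1.smul aestronglyMeasurable_const)
    (ae_of_all _ fun l => by rw [norm_smul, mul_comm])

theorem memLp_thermalSpectrum_ohmic {β η ωc : ℝ} (hβ : 0 < β) (hωc : 0 < ωc) {p : ℝ≥0∞}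
    (hp : 1 ≤ p) : MemLp (thermalSpectrum β (powerLawJ η ωc 1)) p := by
  obtain ⟨K, hK, hb⟩ := exists_abs_thermalSpectrum_powerLawJ_le (η := η) 1 hβ hωc
  refine (memLp_inv_one_add_abs_sq hp).of_le_mul (c := K)
    (measurable_thermalSpectrum β (measurable_powerLawJ η ωc 1)).aestronglyMeasurable ?_
  filter_upwards [Measure.ae_ne volume 0] with l hl
  have := hb l hl
  rw [sub_self, Real.rpow_zero, mul_one] at this
  rwa [Real.norm_of_nonneg (by positivity : 0 ≤ ((1 + |l|)⁻¹) ^ 2)]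

/-- `J(|l|)/|l|` decays like `l^{-2}` and the thermal factor grows at most linearly, so the
comparison function is `(1 + |l|)⁻¹`; this forces `p > 1`. -/
theorem memLp_thermalSpectrum_drudeLorentz {β Λ γ : ℝ} (hβ : 0 < β) (hγ : 0 < γ)
    {p : ℝ≥0∞} (hp : 1 < p) : MemLp (thermalSpectrum β (drudeLorentzJ Λ γ)) p := by
  refine (memLp_inv_one_add_abs hp).of_le_mul
    (c := |2 * Λ * γ| * ((1 / β + 1) * (2 * (1 + 1 / γ ^ 2))))
    (measurable_thermalSpectrum β (measurable_drudeLorentzJ Λ γ)).aestronglyMeasurable ?_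
  filter_upwards [Measure.ae_ne volume 0] with l hl
  have hl0 : 0 < |l| := abs_pos.2 hl
  rw [Real.norm_of_nonneg (by positivity : 0 ≤ (1 + |l|)⁻¹)]
  refine (abs_thermalSpectrum_le hβ _ l).trans ?_
  have hJ : |drudeLorentzJ Λ γ (|l|)| / |l| = |2 * Λ * γ| / (l ^ 2 + γ ^ 2) := by
    rw [drudeLorentzJ, abs_div, abs_mul, abs_abs, sq_abs,
      abs_of_pos (by positivity : 0 < l ^ 2 + γ ^ 2)]
    field_simp
  have h1 : (1 + |l|) ^ 2 ≤ 2 * (1 + 1 / γ ^ 2) * (l ^ 2 + γ ^ 2) := by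
    have h2 : (1 + 1 / γ ^ 2) * (l ^ 2 + γ ^ 2) = l ^ 2 + γ ^ 2 + l ^ 2 / γ ^ 2 + 1 := by
      field_simp
      ring
    have h3 : 0 ≤ l ^ 2 / γ ^ 2 := by positivity
    rw [mul_assoc, h2]
    nlinarith [sq_abs l, sq_nonneg (|l| - 1), sq_nonneg γ]
  have h4 : 1 + |l| ≤ 2 * (1 + 1 / γ ^ 2) * (l ^ 2 + γ ^ 2) * (1 + |l|)⁻¹ := by
    rwa [← div_eq_mul_inv, le_div_iff₀ (by positivity), ← sq]
  rw [hJ, div_mul_eq_mul_div, div_le_iff₀ (by positivity)]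
  calc |2 * Λ * γ| * ((1 / β + 1) * (1 + |l|))
      ≤ |2 * Λ * γ| * ((1 / β + 1) * (2 * (1 + 1 / γ ^ 2) * (l ^ 2 + γ ^ 2) * (1 + |l|)⁻¹)) := by
        gcongr
    _ = _ := by ring

theorem memLp_lorentzian (ω₀ : ℝ) {γ : ℝ} (hγ : 0 < γ) {p : ℝ≥0∞} (hp : 1 ≤ p) :
    MemLp (lorentzian ω₀ γ) p := by
  -- The Lorentzian is `γ / ‖z - l‖²` for this `z`, so the Cauchy kernel estimate applies squared.
  set z : ℂ := ⟨ω₀, γ⟩ with hz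
  have hzi : 0 < z.im := hγ
  have hc : Continuous (lorentzian ω₀ γ) :=
    continuous_const.div (by fun_prop) fun l => by positivity
  refine (memLp_inv_one_add_abs_sq hp).of_le_mul (c := γ * ((1 + ‖z‖) / z.im + 1) ^ 2)
    hc.aestronglyMeasurable (ae_of_all _ fun l => ?_)
  have h1 := one_add_abs_le_mul_norm_sub hzi l
  have h2 : ‖z - l‖ ^ 2 = (l - ω₀) ^ 2 + γ ^ 2 := by
    rw [← Complex.normSq_eq_norm_sq, Complex.normSq_apply]
    simp [hz]
    ring
  have h3 : (1 + |l|) ^ 2 ≤ ((1 + ‖z‖) / z.im + 1) ^ 2 * ((l - ω₀) ^ 2 + γ ^ 2) := by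
    rw [← h2, ← mul_pow]
    gcongr
  rw [lorentzian, Real.norm_of_nonneg (by positivity), Real.norm_of_nonneg (by positivity),
    div_le_iff₀ (by positivity), inv_pow, mul_assoc, mul_assoc, mul_comm _ ((l - ω₀) ^ 2 + γ ^ 2),
    ← mul_assoc (((1 + ‖z‖) / z.im + 1) ^ 2), ← div_eq_mul_inv]
  refine le_mul_of_one_le_right hγ.le ?_
  rwa [one_le_div (by positivity)]

/-- The quotient is the reciprocal of a difference quotient of `1 - e^{-βl}` at `0`, where the
derivative is `β`. -/
theorem tendsto_div_one_sub_exp_neg {β : ℝ} (hβ : 0 < β) :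
    Tendsto (fun l : ℝ => l / (1 - Real.exp (-β * l))) (𝓝[≠] 0) (𝓝 (1 / β)) := by
  have h1 : HasDerivAt (fun l : ℝ => 1 - Real.exp (-β * l)) β 0 := by
    have h2 := (((hasDerivAt_id (0 : ℝ)).const_mul (-β)).exp).const_sub 1
    simpa using h2
  have h3 := (hasDerivAt_iff_tendsto_slope.1 h1).inv₀ hβ.ne'
  rw [← one_div] at h3
  refine h3.congr fun l => ?_
  simp [slope_def_field]

theorem tendsto_thermalSpectrum_powerLawJ_div {β η ωc : ℝ} (s : ℝ) (hβ : 0 < β)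
    (hωc : 0 < ωc) :
    Tendsto (fun l => thermalSpectrum β (powerLawJ η ωc s) l / |l| ^ (s - 1)) (𝓝[≠] 0)
      (𝓝 (η * ωc ^ (1 - s) / β)) := by
  have hc : Continuous fun l : ℝ => η * ωc ^ (1 - s) * Real.exp (-|l| / ωc) := by fun_prop
  have h1 := ((hc.tendsto 0).mono_left nhdsWithin_le_nhds).mul (tendsto_div_one_sub_exp_neg hβ)
    (x := 𝓝[≠] 0)
  simp only [abs_zero, neg_zero, zero_div, Real.exp_zero, mul_one, mul_one_div] at h1
  refine h1.congr' ?_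
  filter_upwards [self_mem_nhdsWithin] with l hl
  have hl0 : 0 < |l| := abs_pos.2 hl
  have hpos : 0 < |l| ^ s := Real.rpow_pos_of_pos hl0 s
  rw [thermalSpectrum_eq, powerLawJ, Real.rpow_sub_one hl0.ne', ← neg_sub s 1,
    Real.rpow_neg hωc.le]
  field_simp

theorem isSubOhmicDensity_thermalSpectrum {E : Type*} [NormedAddCommGroup E] [NormedSpace ℂ E]
    {β η ωc s : ℝ} {A : E} (hβ : 0 < β) (hη : 0 < η) (hωc : 0 < ωc) (hs0 : 0 < s) (hs : s < 1)
    (hA : A ≠ 0) :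
    IsSubOhmicDensity s (fun l => thermalSpectrum β (powerLawJ η ωc s) l • A) := by
  have hm := measurable_thermalSpectrum β (measurable_powerLawJ η ωc s)
  have hθ : (fun l : ℝ => ‖thermalSpectrum β (powerLawJ η ωc s) l • A‖) =Θ[𝓝[≠] 0]
      (fun l : ℝ => |l| ^ (s - 1)) := by
    have h1 : (thermalSpectrum β (powerLawJ η ωc s)) =Θ[𝓝[≠] 0] (fun l : ℝ => |l| ^ (s - 1)) :=
      (isTheta_of_div_tendsto_nhds_ne_zero (tendsto_thermalSpectrum_powerLawJ_div s hβ hωc)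
        (by positivity)).symm
    simp only [norm_smul, mul_comm _ ‖A‖]
    exact (isTheta_const_mul_left (norm_ne_zero_iff.2 hA)).2 h1.norm_left
  have haway : ∀ δ : ℝ, 0 < δ → ∀ q : ℝ≥0∞, 1 ≤ q →
      MemLp (fun l => thermalSpectrum β (powerLawJ η ωc s) l • A) q
        (volume.restrict {l : ℝ | δ ≤ |l|}) := by
    intro δ hδ q hq
    obtain ⟨K, hK, hb⟩ := exists_abs_thermalSpectrum_powerLawJ_le (η := η) s hβ hωc
    refine memLp_smul_vector ?_ A
    refine ((memLp_inv_one_add_abs_sq hq).restrict _).of_le_mul (c := K * δ ^ (s - 1))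
      hm.aestronglyMeasurable ?_
    have hms : MeasurableSet {l : ℝ | δ ≤ |l|} := measurableSet_le measurable_const measurable_abs
    filter_upwards [ae_restrict_mem hms] with l hl
    have hl' : δ ≤ |l| := hl
    rw [Real.norm_of_nonneg (by positivity : 0 ≤ ((1 + |l|)⁻¹) ^ 2)]
    refine (hb l (abs_pos.1 (hδ.trans_le hl'))).trans ?_
    gcongr ?_ * ?_ * _
    exact Real.rpow_le_rpow_of_nonpos hδ hl' (by linarith)
  refine ⟨?_, hθ, fun δ hδ q hq _ => haway δ hδ q hq⟩
  rw [← memLp_one_iff_integrable]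
  refine memLp_of_isBigO_rpow hs (hm.aestronglyMeasurable.smul aestronglyMeasurable_const)
    hθ.isBigO one_ne_zero (fun δ hδ => haway δ hδ 1 le_rfl) ?_
  -- Integrability is the subcritical case `p = 1`, since `1 < 1/(1-s)` for `s > 0`.
  rw [ENNReal.one_lt_ofReal, one_lt_div (by linarith)]
  linarith

end Baths

theorem theorem2
    -- a finite-dimensional system Liouville space, with any inner product
    {V : Type*} [NormedAddCommGroup V] [InnerProductSpace ℂ V] [FiniteDimensional ℂ V]
    -- a bath Hilbert space, and the number of levels of the system
    {Hb : Type*} [NormedAddCommGroup Hb] [InnerProductSpace ℂ Hb] [CompleteSpace Hb] {d : ℕ} :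
    -- Hardy placement of the Nakajima-Zwanzig kernel
    (∀ (S : OpenSystem d Hb) (K : ℝ → SysLiouville d →L[ℂ] SysLiouville d)
        (Kt : ℂ → SysLiouville d →L[ℂ] SysLiouville d)
        (w : ℝ → SysLiouville d →L[ℂ] SysLiouville d) (p₀ : ℝ≥0∞),
      S.IsMemoryKernel K → IsLaplaceTransform K Kt → IsCauchyTransform w Kt →
      1 < p₀ → MemLp w 1 → MemLp w p₀ →
      ∀ p : ℝ≥0∞, 1 < p → p ≤ p₀ → p ≠ ⊤ → MemHardy p Kt) ∧
    -- the same for every other choice of projection and inner product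
    (∀ (Kt : ℂ → V →L[ℂ] V) (w : ℝ → V →L[ℂ] V) (p₀ : ℝ≥0∞),
      IsCauchyTransform w Kt → 1 < p₀ → MemLp w 1 → MemLp w p₀ →
      ∀ p : ℝ≥0∞, 1 < p → p ≤ p₀ → p ≠ ⊤ → MemHardy p Kt) ∧
    -- Ohmic baths: every finite `p₀` is admissible
    (∀ (β η ωc : ℝ) (A : V →L[ℂ] V) (Kt : ℂ → V →L[ℂ] V), 0 < β → 0 < η → 0 < ωc →
      IsCauchyTransform (fun l => thermalSpectrum β (powerLawJ η ωc 1) l • A) Kt →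
      MemLp (fun l => thermalSpectrum β (powerLawJ η ωc 1) l • A) 1 ∧
      ∀ p : ℝ≥0∞, 1 < p → p ≠ ⊤ →
        MemLp (fun l => thermalSpectrum β (powerLawJ η ωc 1) l • A) p ∧ MemHardy p Kt) ∧
    -- Drude-Lorentz baths: every finite `p₀ > 1` is admissible
    (∀ (β Λ γ : ℝ) (A : V →L[ℂ] V) (Kt : ℂ → V →L[ℂ] V), 0 < β → 0 < Λ → 0 < γ →
      IsCauchyTransform (fun l => thermalSpectrum β (drudeLorentzJ Λ γ) l • A) Kt →
      ∀ p : ℝ≥0∞, 1 < p → p ≠ ⊤ →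
        MemLp (fun l => thermalSpectrum β (drudeLorentzJ Λ γ) l • A) p ∧ MemHardy p Kt) ∧
    -- Lorentzian baths: every finite `p₀` is admissible
    (∀ (ω₀ γ : ℝ) (A : V →L[ℂ] V) (Kt : ℂ → V →L[ℂ] V), 0 < γ →
      IsCauchyTransform (fun l => lorentzian ω₀ γ l • A) Kt →
      MemLp (fun l => lorentzian ω₀ γ l • A) 1 ∧
      ∀ p : ℝ≥0∞, 1 < p → p ≠ ⊤ →
        MemLp (fun l => lorentzian ω₀ γ l • A) p ∧ MemHardy p Kt) ∧
    -- sub-Ohmic behaviour at zero forces `p₀ < 1 / (1 - s)`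
    (∀ (s : ℝ) (w : ℝ → V →L[ℂ] V) (p₀ : ℝ≥0∞), 0 < s → s < 1 →
      (fun l : ℝ => ‖w l‖) =Θ[𝓝[≠] 0] (fun l : ℝ => |l| ^ (s - 1)) →
      MemLp w p₀ → p₀ < ENNReal.ofReal (1 / (1 - s))) ∧
    -- sub-Ohmic densities: the admissible range is exactly `(1, 1 / (1 - s))`
    (∀ (s : ℝ) (w : ℝ → V →L[ℂ] V) (Kt : ℂ → V →L[ℂ] V), 0 < s → s < 1 →
      IsSubOhmicDensity s w → IsCauchyTransform w Kt →
      ∀ p : ℝ≥0∞, 1 < p →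
        (MemLp w p ↔ p < ENNReal.ofReal (1 / (1 - s))) ∧
        (p < ENNReal.ofReal (1 / (1 - s)) → MemHardy p Kt)) ∧
    -- the bath spectral density `ω^s e^{-ω/ωc}` has sub-Ohmic behaviour
    (∀ (β η ωc s : ℝ) (A : V →L[ℂ] V), 0 < β → 0 < η → 0 < ωc → 0 < s → s < 1 → A ≠ 0 →
      IsSubOhmicDensity s (fun l => thermalSpectrum β (powerLawJ η ωc s) l • A) ∧
      Tendsto (fun l => thermalSpectrum β (powerLawJ η ωc s) l / |l| ^ (s - 1)) (𝓝[≠] 0)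
        (𝓝 (η * ωc ^ (1 - s) / β))) ∧
    -- the admissible range shrinks to the empty set as `s → 0`
    Tendsto (fun s : ℝ => 1 / (1 - s)) (𝓝[>] 0) (𝓝 1) := by
  have hsubL : ∀ (s : ℝ) (w : ℝ → V →L[ℂ] V) (p : ℝ≥0∞), s < 1 → IsSubOhmicDensity s w →
      1 < p → p < ENNReal.ofReal (1 / (1 - s)) → MemLp w p := fun s w p hs hw hp hps =>
    memLp_of_isBigO_rpow hs hw.integrable.aestronglyMeasurable hw.near_zero.isBigO
      (zero_lt_one.trans hp).ne'
      (fun δ hδ => hw.away δ hδ p hp.le (hps.trans ENNReal.ofReal_lt_top).ne) hps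
  refine ⟨?_, ?_, ?_, ?_, ?_, ?_, ?_, ?_, ?_⟩
  · intro S K Kt w p₀ _ _ hKt _ h1 hp₀ p hp hpp₀ hpt
    exact hKt.memHardy hp hpt (memLp_of_memLp_one h1 hp₀ hp hpp₀ hpt)
  · intro Kt w p₀ hKt _ h1 hp₀ p hp hpp₀ hpt
    exact hKt.memHardy hp hpt (memLp_of_memLp_one h1 hp₀ hp hpp₀ hpt)
  · intro β η ωc A Kt hβ _ hωc hKt
    have hL : ∀ p : ℝ≥0∞, 1 ≤ p →
        MemLp (fun l => thermalSpectrum β (powerLawJ η ωc 1) l • A) p := fun p hp =>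
      memLp_smul_vector (memLp_thermalSpectrum_ohmic hβ hωc hp) A
    exact ⟨hL 1 le_rfl, fun p hp hpt => ⟨hL p hp.le, hKt.memHardy hp hpt (hL p hp.le)⟩⟩
  · intro β Λ γ A Kt hβ _ hγ hKt p hp hpt
    have hL := memLp_smul_vector (memLp_thermalSpectrum_drudeLorentz (Λ := Λ) hβ hγ hp) A
    exact ⟨hL, hKt.memHardy hp hpt hL⟩
  · intro ω₀ γ A Kt hγ hKt
    have hL : ∀ p : ℝ≥0∞, 1 ≤ p → MemLp (fun l => lorentzian ω₀ γ l • A) p := fun p hp =>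
      memLp_smul_vector (memLp_lorentzian ω₀ hγ hp) A
    exact ⟨hL 1 le_rfl, fun p hp hpt => ⟨hL p hp.le, hKt.memHardy hp hpt (hL p hp.le)⟩⟩
  · intro s w p₀ _ hs hθ hw
    exact lt_ofReal_of_memLp_of_isBigO_rpow hs hθ.isBigO_symm hw
  · intro s w Kt _ hs hw hKt p hp
    exact ⟨⟨lt_ofReal_of_memLp_of_isBigO_rpow hs hw.near_zero.isBigO_symm, hsubL s w p hs hw hp⟩,
      fun hps => hKt.memHardy hp (hps.trans ENNReal.ofReal_lt_top).ne (hsubL s w p hs hw hp hps)⟩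
  · intro β η ωc s A hβ hη hωc hs0 hs hA
    exact ⟨isSubOhmicDensity_thermalSpectrum hβ hη hωc hs0 hs hA,
      tendsto_thermalSpectrum_powerLawJ_div s hβ hωc⟩
  · have hc : ContinuousAt (fun s : ℝ => 1 / (1 - s)) 0 :=
      continuousAt_const.div (by fun_prop) (by norm_num)
    have := hc.tendsto.mono_left (nhdsWithin_le_nhds (s := Ioi 0))
    simpa using this
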